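/- Let $U\subset\mathbb R^{m}$ be a domain (nonempty, connected and open), and let $F$ be a $C^1$ vector field on $U$. For a real-valued $C^2$ function $u$ on $U$ put $$N_F(u):=\frac{\nabla u+F}{|\nabla u+F|},\qquad H_F(u):=\operatorname{div}N_F(u)$$ at points where $\nabla u+F\neq 0$; $U$ is called a nonsingular domain for $u$ if $\nabla u+F\ne 0$ at every point of $U$. For $m=2n$ let $F=(-x^2,x^1,\dots,-x^{2n},x^{2n-1})$; then $H_F(u)$ is the horizontal ($p$-) mean curvature (up to sign) of the graph of $u$ in the Heisenberg group $H_n$. **Corollary I.** Let $m=2n\ge 4$ and $F=(-x^2,x^1,\dots,-x^{2n},x^{2n-1})$. Let $u,v$ be $C^2$ real-valued functions on a domain $U\subset\mathbb R^{2n}$ that is nonsingular for both $u$ and $v$. Suppose $H_F(u)\le H_F(v)$ and $u\ge v$ in $U$, and $u=v$ at some point $p_0\in U$. Then $u\equiv v$ in $U$. This fails for $m=2$, $F=(-x^2,x^1)$: let $U=\{x^1>0,\ x^1+x^2>0\}\subset\mathbb R^2$, $u=x^1x^2+(x^2)^2$ and $v=x^1x^2$. Then $u,v$ are $C^2$ on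 $U$, $U$ is a nonsingular domain for both $u$ and $v$, $H_F(u)=H_F(v)=0$ and $u\ge v$ in $U$, and $u=v$ at some point of $U$; in fact, at a point of $U$, $u=v$ holds if and only if $x^2=0$. In particular $u\not\equiv v$ in $U$. -/

import Mathlib

noncomputable section

/-- Divergence `∑ i, ∂ V_i / ∂ x^i` of a vector field on `ℝ^m`. -/
def divergence {m : ℕ} (V : EuclideanSpace ℝ (Fin m) → EuclideanSpace ℝ (Fin m))
    (x : EuclideanSpace ℝ (Fin m)) : ℝ :=
  ∑ i : Fin m, (fderiv ℝ V x (EuclideanSpace.single i 1)) i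

/-- The Legendrian (or horizontal) normal `N_F(u) = (∇u + F) / |∇u + F|`;
meaningful where `∇u + F ≠ 0`. -/
def legendrianNormal {m : ℕ} (F : EuclideanSpace ℝ (Fin m) → EuclideanSpace ℝ (Fin m))
    (u : EuclideanSpace ℝ (Fin m) → ℝ) (x : EuclideanSpace ℝ (Fin m)) :
    EuclideanSpace ℝ (Fin m) :=
  ‖gradient u x + F x‖⁻¹ • (gradient u x + F x)

/-- The generalized horizontal (or `p`-) mean curvature `H_F(u) = div N_F(u)`. -/
def horizontalMeanCurvature {m : ℕ}
    (F : EuclideanSpace ℝ (Fin m) → EuclideanSpace ℝ (Fin m))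
    (u : EuclideanSpace ℝ (Fin m) → ℝ) (x : EuclideanSpace ℝ (Fin m)) : ℝ :=
  divergence (legendrianNormal F u) x

/-- `U` is a nonsingular domain for `u`: a connected open set on which `∇u + F` never vanishes. -/
def IsNonsingularDomain {m : ℕ} (F : EuclideanSpace ℝ (Fin m) → EuclideanSpace ℝ (Fin m))
    (u : EuclideanSpace ℝ (Fin m) → ℝ) (U : Set (EuclideanSpace ℝ (Fin m))) : Prop :=
  IsOpen U ∧ IsConnected U ∧ ∀ x ∈ U, gradient u x + F x ≠ 0

/-- The vector field `F = (-x², x¹, …, -x²ⁿ, x²ⁿ⁻¹)` on `ℝ^{2n}`. The coordinate `xʲ` (`j ≥ 1`)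
has index `j - 1` in `Fin (2 * n)`. -/
def heisenbergField (n : ℕ) (x : EuclideanSpace ℝ (Fin (2 * n))) :
    EuclideanSpace ℝ (Fin (2 * n)) :=
  WithLp.toLp 2 fun i : Fin (2 * n) =>
    if h : i.val % 2 = 0 then -x ⟨i.val + 1, by have := i.isLt; omega⟩
    else x ⟨i.val - 1, by have := i.isLt; omega⟩

end

/-! Let `w = u - v ≥ 0`, `Z = {w = 0}` and `a = ∇u + F`. The derivative of `p ↦ p / ‖p‖` is a
positive multiple of the projection onto the complement of `p`, so near each point of `Z` the
curvature inequality makes `w` a supersolution of a linear operator that is elliptic except in the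
direction `a`. A Hopf barrier shows that a ball touching `Z` from outside has normal parallel to `a`
(`exists_eq_smul_of_touching_ball`). By Bony's argument, flows of fields orthogonal to `a` locally
preserve `Z` (`mem_of_integralCurve_of_inner_normal_eq_zero`).

If `Z ≠ U`, some exterior ball touches `Z` at a point `p`. Flowing around a commutator of two fields
`X`, `Y` orthogonal to `a` gives points `p + t² [X, Y](p) + o(t²)` of `Z`. These avoid the ball, and
exchanging `X` and `Y` forces `⟪a, [X, Y]⟫ = 0` at `p`. The Hessian of `u` is symmetric, so for a
skew linear field `F = J` this pairing is a nonzero multiple of `⟪J ξ, ζ⟫`, where `ξ`, `ζ` are the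
directions of the two fields at `p`. In dimension at least three some `ξ ≠ 0` is orthogonal to `a`
and `J a`; with `ζ = J ξ` the pairing is nonzero, a contradiction.

For `m = 2` the fields orthogonal to `a` span a line and their brackets stay in it. In the example
both normals are the same constant vector. -/

section

open Filter Topology Set Metric Asymptotics
open scoped RealInnerProductSpace

/-! ### Second-order condition at a minimum; derivative of normalization. -/

section Hessian

variable {E : Type*} [NormedAddCommGroup E] [InnerProductSpace ℝ E]

/-- The Hessian at a local minimum is positive semidefinite. -/
lemma IsLocalMin.inner_hessian_nonneg [CompleteSpace E] {f : E → ℝ} {G : E → E} {G' : E →L[ℝ] E} {x : E}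
    (hmin : IsLocalMin f x) (hG : ∀ᶠ x' in 𝓝 x, HasGradientAt f (G x') x')
    (hG' : HasFDerivAt G G' x) (ξ : E) : 0 ≤ ⟪G' ξ, ξ⟫ := by
  set φ : ℝ → ℝ := fun t => f (x + t • ξ) with hφ
  have hline (t : ℝ) : HasDerivAt (fun t : ℝ => x + t • ξ) ξ t := by
    simpa using ((hasDerivAt_id t).smul_const ξ).const_add x
  have htend : Tendsto (fun t : ℝ => x + t • ξ) (𝓝 0) (𝓝 x) := by
    simpa using (hline 0).continuousAt.tendsto
  have hd : ∀ᶠ t in 𝓝 (0 : ℝ), HasDerivAt φ ⟪G (x + t • ξ), ξ⟫ t := by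
    filter_upwards [htend.eventually hG] with t ht
    have h := ht.hasFDerivAt.comp_hasDerivAt t (hline t)
    rwa [InnerProductSpace.toDual_apply_apply] at h
  have hderiv : deriv φ =ᶠ[𝓝 0] fun t => ⟪G (x + t • ξ), ξ⟫ := hd.mono fun t ht => ht.deriv
  have hd2 : HasDerivAt (fun t : ℝ => ⟪G (x + t • ξ), ξ⟫) ⟪G' ξ, ξ⟫ 0 := by
    have h1 : HasDerivAt (fun t : ℝ => G (x + t • ξ)) (G' ξ) 0 :=
      HasFDerivAt.comp_hasDerivAt (0 : ℝ) (by simpa using hG') (hline 0)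
    simpa using h1.inner ℝ (hasDerivAt_const (0 : ℝ) ξ)
  have hdd : deriv (deriv φ) 0 = ⟪G' ξ, ξ⟫ := by rw [hderiv.deriv_eq, hd2.deriv]
  have hφmin : IsLocalMin φ 0 := by
    have := htend.eventually hmin
    filter_upwards [this] with t ht
    simpa [hφ] using ht
  -- A negative second derivative would make `0` a local maximum as well, so `φ` would be locally
  -- constant and its second derivative zero.
  by_contra! hneg
  have hmax : IsLocalMax φ 0 := isLocalMax_of_deriv_deriv_neg (by rwa [hdd])
    hφmin.deriv_eq_zero hd.self_of_nhds.continuousAt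
  have hconst : φ =ᶠ[𝓝 0] fun _ => φ 0 := by
    filter_upwards [hφmin, hmax] with t h1 h2 using le_antisymm h2 h1
  have : deriv (deriv φ) 0 = 0 := by
    have h1 : deriv φ =ᶠ[𝓝 0] deriv fun _ => φ 0 := hconst.deriv
    rw [h1.deriv_eq]
    simp
  linarith

/-- The normalization map `p ↦ p / ‖p‖`. -/
noncomputable def unitMap (p : E) : E := ‖p‖⁻¹ • p

lemma contDiffAt_unitMap {p : E} (hp : p ≠ 0) {n : WithTop ℕ∞} : ContDiffAt ℝ n unitMap p :=
  ((contDiffAt_norm ℝ hp).inv (norm_ne_zero_iff.2 hp)).smul contDiffAt_id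

/-- This projection formula locates the degeneracy of `H_F`: the kernel is exactly the line through
`p`. -/
lemma fderiv_unitMap {p : E} (hp : p ≠ 0) (ξ : E) :
    fderiv ℝ unitMap p ξ = ‖p‖⁻¹ • (ξ - ⟪unitMap p, ξ⟫ • unitMap p) := by
  have hp' := norm_ne_zero_iff.2 hp
  have hn : DifferentiableAt ℝ (fun q : E => ‖q‖) p :=
    (contDiffAt_norm ℝ hp (n := 1)).differentiableAt (by simp)
  have hnd : fderiv ℝ (fun q : E => ‖q‖) p ξ = ‖p‖⁻¹ * ⟪p, ξ⟫ := by
    have h1 : HasFDerivAt (fun q : E => ‖q‖ ^ 2) (2 • (innerSL ℝ p)) p :=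
      (hasStrictFDerivAt_norm_sq p).hasFDerivAt
    have h2 := (hn.hasFDerivAt.pow 2).unique h1
    have h3 := congrArg (fun L : E →L[ℝ] ℝ => L ξ) h2
    simp at h3
    field_simp
    linarith
  have h : HasFDerivAt unitMap _ p :=
    ((hasDerivAt_inv hp').comp_hasFDerivAt p hn.hasFDerivAt).smul (hasFDerivAt_id p)
  rw [h.fderiv]
  simp [hnd, unitMap, inner_smul_left, smul_sub, smul_smul]
  rw [sub_eq_add_neg, ← neg_smul, ← neg_smul]
  congr 2
  field_simp

end Hessian

/-! ### The trace as a functional, and its positivity. -/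

section Trace

variable {m : ℕ}

/-- The trace of an endomorphism of `ℝ^m`, as a continuous linear functional. -/
noncomputable def traceCLM (m : ℕ) :
    (EuclideanSpace ℝ (Fin m) →L[ℝ] EuclideanSpace ℝ (Fin m)) →L[ℝ] ℝ :=
  ∑ i : Fin m, (EuclideanSpace.proj i : EuclideanSpace ℝ (Fin m) →L[ℝ] ℝ).comp
    (ContinuousLinearMap.apply ℝ _ (EuclideanSpace.single i (1 : ℝ)))

lemma traceCLM_apply (L : EuclideanSpace ℝ (Fin m) →L[ℝ] EuclideanSpace ℝ (Fin m)) :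
    traceCLM m L = ∑ i, ⟪EuclideanSpace.single i (1 : ℝ), L (EuclideanSpace.single i 1)⟫ := by
  simp [traceCLM, EuclideanSpace.inner_single_left]

lemma divergence_eq_traceCLM (V : EuclideanSpace ℝ (Fin m) → EuclideanSpace ℝ (Fin m))
    (x : EuclideanSpace ℝ (Fin m)) : divergence V x = traceCLM m (fderiv ℝ V x) := by
  simp [traceCLM, divergence]

lemma EuclideanSpace.sum_coord_smul_single (z : EuclideanSpace ℝ (Fin m)) :
    ∑ i, z i • EuclideanSpace.single i (1 : ℝ) = z := by
  have := (EuclideanSpace.basisFun (Fin m) ℝ).sum_repr z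
  simpa using this

/-- Evaluates the principal part on the rank-one term of the barrier's Hessian. -/
lemma traceCLM_rankOne (L : EuclideanSpace ℝ (Fin m) →L[ℝ] EuclideanSpace ℝ (Fin m))
    (z : EuclideanSpace ℝ (Fin m)) :
    traceCLM m (L.comp ((innerSL ℝ z).smulRight z)) = ⟪z, L z⟫ := by
  rw [traceCLM_apply]
  conv_rhs => rw [← EuclideanSpace.sum_coord_smul_single z, sum_inner]
  rw [EuclideanSpace.sum_coord_smul_single]
  refine Finset.sum_congr rfl fun i _ => ?_
  simp [inner_smul_left, EuclideanSpace.inner_single_left, EuclideanSpace.inner_single_right]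

/-- `tr (P S) ≥ 0` if `S` is positive semidefinite and `P` is a multiple of the orthogonal
projection along the unit vector `N`. -/
lemma traceCLM_comp_nonneg {P S : EuclideanSpace ℝ (Fin m) →L[ℝ] EuclideanSpace ℝ (Fin m)}
    {N : EuclideanSpace ℝ (Fin m)} {k : ℝ} (hk : 0 ≤ k) (hN : ‖N‖ = 1)
    (hP : ∀ ξ, P ξ = k • (ξ - ⟪N, ξ⟫ • N)) (hS : ∀ ξ, 0 ≤ ⟪S ξ, ξ⟫) :
    0 ≤ traceCLM m (P.comp S) := by
  rw [traceCLM_apply]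
  set e : Fin m → EuclideanSpace ℝ (Fin m) := fun i => EuclideanSpace.single i (1 : ℝ) with he
  have hN2 : ⟪N, N⟫ = 1 := by rw [real_inner_self_eq_norm_sq, hN]; norm_num
  have hNe (i) : ⟪N, e i⟫ = N i := by simp [he, EuclideanSpace.inner_single_right]
  -- The vectors `e i - N i • N` are the projections of the basis. The correction terms sum to `⟪N,
  -- S N⟫ - ⟪N, S N⟫ = 0`.
  have h1 (i : Fin m) : ⟪e i, (P.comp S) (e i)⟫
      = k * (⟪S (e i - N i • N), e i - N i • N⟫ + N i * ⟪e i - N i • N, S N⟫) := by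
    simp only [ContinuousLinearMap.comp_apply, hP, inner_smul_right, inner_sub_right,
      inner_sub_left, map_sub, map_smul, inner_smul_left, hNe, real_inner_comm N (e i)]
    rw [real_inner_comm (S (e i)) (e i), real_inner_comm (S (e i)) N, real_inner_comm (S N) N,
      real_inner_comm (S N) (e i)]
    simp only [conj_trivial]
    ring
  change 0 ≤ ∑ i, ⟪e i, (P.comp S) (e i)⟫
  simp_rw [h1]
  rw [← Finset.mul_sum, Finset.sum_add_distrib]
  have h2 : ∑ i, N i * ⟪e i - N i • N, S N⟫ = 0 := by
    have h3 (i) : N i * ⟪e i - N i • N, S N⟫ = ⟪N i • e i, S N⟫ - (N i * N i) * ⟪N, S N⟫ := by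
      simp only [inner_sub_left, inner_smul_left]
      simp
      ring
    simp_rw [h3]
    rw [Finset.sum_sub_distrib, ← sum_inner, ← Finset.sum_mul]
    have h4 : ∑ i, N i * N i = 1 := by
      rw [← hN2, PiLp.inner_apply]
      simp [sq]
    rw [h4, he, EuclideanSpace.sum_coord_smul_single]
    ring
  rw [h2]
  exact mul_nonneg hk (add_nonneg (Finset.sum_nonneg fun i _ => hS _) le_rfl)

end Trace

/-! ### Hopf's lemma for degenerate elliptic inequalities. -/

section Barrier

variable {m : ℕ}

lemma hasGradientAt_exp_neg_mul_sq {E : Type*} [NormedAddCommGroup E] [InnerProductSpace ℝ E]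
    [CompleteSpace E] (α b : ℝ) (c x : E) :
    HasGradientAt (fun x => Real.exp (-α * ‖x - c‖ ^ 2) - b)
      ((-2 * α * Real.exp (-α * ‖x - c‖ ^ 2)) • (x - c)) x := by
  have h1 : HasFDerivAt (fun x : E => ‖x - c‖ ^ 2) (2 • (innerSL ℝ (x - c))) x := by
    simpa using ((hasFDerivAt_id x).sub_const c).norm_sq
  rw [hasGradientAt_iff_hasFDerivAt]
  refine (((h1.const_mul (-α)).exp).sub_const b).congr_fderiv ?_
  ext ξ
  simp
  ring

lemma hasFDerivAt_exp_neg_mul_sq_smul {E : Type*} [NormedAddCommGroup E] [InnerProductSpace ℝ E]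
    (α : ℝ) (c x : E) :
    HasFDerivAt (fun x => (-2 * α * Real.exp (-α * ‖x - c‖ ^ 2)) • (x - c))
      ((2 * α * Real.exp (-α * ‖x - c‖ ^ 2)) •
        ((2 * α) • (innerSL ℝ (x - c)).smulRight (x - c) - ContinuousLinearMap.id ℝ E)) x := by
  have h1 : HasFDerivAt (fun x : E => ‖x - c‖ ^ 2) (2 • (innerSL ℝ (x - c))) x := by
    simpa using ((hasFDerivAt_id x).sub_const c).norm_sq
  refine ((((h1.const_mul (-α)).exp).const_mul (-2 * α)).smul
    ((hasFDerivAt_id x).sub_const c)).congr_fderiv ?_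
  refine ContinuousLinearMap.ext fun ξ => ?_
  simp only [add_apply, sub_apply,
    smul_apply, ContinuousLinearMap.smulRight_apply,
    ContinuousLinearMap.id_apply, id, smul_eq_mul]
  module

/-- Were the normal nondegenerate, `h = exp(-α‖x - c‖²) - exp(-α‖y - c‖²)` with `α` large would be a
strict subsolution near `y`. Then `w - ε h` has an interior minimum near `y`, where the inequality
for `w` fails. -/
lemma inner_nonpos_of_touching_closedBall
    {g G' : EuclideanSpace ℝ (Fin m) → EuclideanSpace ℝ (Fin m) →L[ℝ] EuclideanSpace ℝ (Fin m)}
    {w : EuclideanSpace ℝ (Fin m) → ℝ} {G : EuclideanSpace ℝ (Fin m) → EuclideanSpace ℝ (Fin m)}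
    {y c : EuclideanSpace ℝ (Fin m)} {C : ℝ} (hg : ContinuousAt g y)
    (hpsd : ∀ᶠ x in 𝓝 y, ∀ S : EuclideanSpace ℝ (Fin m) →L[ℝ] EuclideanSpace ℝ (Fin m),
      (∀ ξ, 0 ≤ ⟪S ξ, ξ⟫) → 0 ≤ traceCLM m ((g x).comp S))
    (hw : ∀ᶠ x in 𝓝 y, 0 ≤ w x) (hwG : ∀ᶠ x in 𝓝 y, HasGradientAt w (G x) x)
    (hG' : ∀ᶠ x in 𝓝 y, HasFDerivAt G (G' x) x)
    (hineq : ∀ᶠ x in 𝓝 y, traceCLM m ((g x).comp (G' x)) ≤ C * ‖G x‖)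
    (hy : w y = 0) (hball : ∀ x ∈ closedBall c ‖y - c‖, x ≠ y → 0 < w x) :
    ⟪y - c, g y (y - c)⟫ ≤ 0 := by
  by_contra! hδ
  set δ := ⟪y - c, g y (y - c)⟫ with hδdef
  -- This `α` makes the quantity in `hQ` at least `1` at `y`; continuity keeps it positive nearby.
  set α := (|traceCLM m (g y)| + |C| * ‖y - c‖ + 1) / (2 * δ) with hα
  have hα0 : 0 < α := by positivity
  set e : EuclideanSpace ℝ (Fin m) → ℝ := fun x => Real.exp (-α * ‖x - c‖ ^ 2) with he
  set h : EuclideanSpace ℝ (Fin m) → ℝ := fun x => e x - Real.exp (-α * ‖y - c‖ ^ 2) with hh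
  have hQ : ∀ᶠ x in 𝓝 y,
      0 < 2 * α * ⟪x - c, g x (x - c)⟫ - traceCLM m (g x) - C * ‖x - c‖ := by
    have hsub : ContinuousAt (fun x => x - c) y := by fun_prop
    have hcont : ContinuousAt
        (fun x => 2 * α * ⟪x - c, g x (x - c)⟫ - traceCLM m (g x) - C * ‖x - c‖) y :=
      ((continuousAt_const.mul (hsub.inner (𝕜 := ℝ) (hg.clm_apply hsub))).sub
        ((traceCLM m).continuous.continuousAt.comp hg)).sub (continuousAt_const.mul hsub.norm)
    refine hcont.tendsto.eventually_const_lt ?_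
    have h1 : 2 * α * δ = |traceCLM m (g y)| + |C| * ‖y - c‖ + 1 := by
      rw [hα]; field_simp
    have h2 := le_abs_self (traceCLM m (g y))
    have h3 : C * ‖y - c‖ ≤ |C| * ‖y - c‖ := by gcongr; exact le_abs_self C
    change 0 < 2 * α * δ - _ - _
    linarith
  obtain ⟨ρ, hρ, hall⟩ := Metric.eventually_nhds_iff_ball.1
    (hpsd.and (hw.and (hwG.and (hG'.and (hineq.and hQ)))))
  have hsub : closedBall y (ρ / 2) ⊆ ball y ρ := closedBall_subset_ball (by linarith)
  have hwc : ContinuousOn w (closedBall y (ρ / 2)) := fun x hx =>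
    (hall x (hsub hx)).2.2.1.continuousAt.continuousWithinAt
  have hhc : Continuous h := by fun_prop
  -- a positive lower bound for `w` on the part of the sphere inside the touching ball
  obtain ⟨ε, hε, hεw⟩ : ∃ ε > 0, ∀ x ∈ sphere y (ρ / 2) ∩ closedBall c ‖y - c‖, ε ≤ w x := by
    rcases (sphere y (ρ / 2) ∩ closedBall c ‖y - c‖).eq_empty_or_nonempty with h0 | hne
    · exact ⟨1, one_pos, by simp [h0]⟩
    · obtain ⟨x0, hx0, hmin⟩ := ((isCompact_sphere y (ρ / 2)).inter_right
        isClosed_closedBall).exists_isMinOn hne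
        (hwc.mono (inter_subset_left.trans sphere_subset_closedBall))
      refine ⟨w x0, hball x0 hx0.2 ?_, fun x hx => hmin hx⟩
      rintro rfl
      have := hx0.1
      simp at this
      linarith
  obtain ⟨x1, hx1, hmin⟩ := (isCompact_closedBall y (ρ / 2)).exists_isMinOn
    ⟨y, by simp; positivity⟩ (hwc.sub (hhc.continuousOn.const_smul ε))
  have hval : w x1 - ε * h x1 ≤ 0 := by
    have h1 : (w - fun x => ε • h x) x1 ≤ (w - fun x => ε • h x) y :=
      hmin (mem_closedBall_self (by positivity))
    simpa [hy, hh, he] using h1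
  have hx1ball : x1 ∈ ball y (ρ / 2) := by
    by_contra hcon
    have hsph : x1 ∈ sphere y (ρ / 2) := by
      rw [mem_sphere]
      rw [mem_closedBall] at hx1
      rw [mem_ball, not_lt] at hcon
      exact le_antisymm hx1 hcon
    -- On the sphere, `w ≥ ε > ε h` inside the touching ball and `w ≥ 0 > ε h` outside it, so `hval`
    -- rules out both.
    by_cases hc : x1 ∈ closedBall c ‖y - c‖
    · have h1 := hεw x1 ⟨hsph, hc⟩
      have h2 : h x1 < 1 := by
        have h3 : e x1 ≤ 1 := Real.exp_le_one_iff.2 (by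
          have := mul_nonneg hα0.le (sq_nonneg ‖x1 - c‖)
          linarith)
        have h4 := Real.exp_pos (-α * ‖y - c‖ ^ 2)
        simp only [hh]
        linarith
      nlinarith
    · have h1 : h x1 < 0 := by
        rw [mem_closedBall, not_le, dist_eq_norm] at hc
        simp only [hh, he, sub_neg, Real.exp_lt_exp]
        have : ‖y - c‖ ^ 2 < ‖x1 - c‖ ^ 2 := by gcongr
        nlinarith
      have h2 := (hall x1 (hsub hx1)).2.1
      nlinarith
  have hmem : ball y (ρ / 2) ∈ 𝓝 x1 := isOpen_ball.mem_nhds hx1ball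
  obtain ⟨p1, -, p3, p4, p5, p6⟩ := hall x1 (hsub hx1)
  have hloc : IsLocalMin (fun x => w x - ε * h x) x1 := by
    filter_upwards [hmem] with x hx using hmin (ball_subset_closedBall hx)
  set Hg : EuclideanSpace ℝ (Fin m) → EuclideanSpace ℝ (Fin m) :=
    fun x => (-2 * α * e x) • (x - c) with hHg
  have hgrad (x) (hx : x ∈ ball y ρ) :
      HasGradientAt (fun x => w x - ε * h x) (G x - ε • Hg x) x := by
    have h1 := (hall x hx).2.2.1.hasFDerivAt
    have h2 := (hasGradientAt_exp_neg_mul_sq α (Real.exp (-α * ‖y - c‖ ^ 2)) c x).hasFDerivAt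
    rw [hasGradientAt_iff_hasFDerivAt]
    refine (h1.sub (h2.const_mul ε)).congr_fderiv ?_
    simp only [map_sub, map_smul, hHg, he]
  have hhess := (p4.sub ((hasFDerivAt_exp_neg_mul_sq_smul α c x1).const_smul ε))
  have hpos := hloc.inner_hessian_nonneg (G := fun x => G x - ε • Hg x)
    (by filter_upwards [isOpen_ball.mem_nhds (hsub hx1)] with x hx using hgrad x hx) hhess
  have hcrit : G x1 = ε • Hg x1 := by
    have h1 := hloc.fderiv_eq_zero
    rw [(hgrad x1 (hsub hx1)).hasFDerivAt.fderiv] at h1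
    have h2 := (InnerProductSpace.toDual ℝ (EuclideanSpace ℝ (Fin m))).injective
      (h1.trans (map_zero _).symm)
    exact sub_eq_zero.1 h2
  have htr := p1 _ hpos
  rw [ContinuousLinearMap.comp_sub, map_sub, ContinuousLinearMap.comp_smul,
    ContinuousLinearMap.comp_smul, ContinuousLinearMap.comp_sub, ContinuousLinearMap.comp_smul,
    ContinuousLinearMap.comp_id, map_smul, map_smul, map_sub, map_smul, traceCLM_rankOne] at htr
  have hex : 0 < e x1 := Real.exp_pos _
  have hnorm : ‖G x1‖ = ε * (2 * α * e x1) * ‖x1 - c‖ := by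
    rw [hcrit, hHg, norm_smul, norm_smul, Real.norm_eq_abs, Real.norm_eq_abs, abs_of_pos hε,
      abs_of_neg (by have := mul_pos hα0 hex; linarith)]
    ring
  rw [hnorm] at p5
  simp only [smul_eq_mul] at htr
  change 0 ≤ _ - ε * (2 * α * e x1 * _) at htr
  have hk : 0 < ε * (2 * α * e x1) := by positivity
  have := mul_pos hk p6
  linarith

/-- Hopf-type lemma: if `w ≥ 0` vanishes at `y`, is positive in a ball with `y` on its boundary,
and satisfies a degenerate elliptic inequality near `y`, then the normal of the ball at `y` is a
degenerate direction. -/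
lemma inner_nonpos_of_touching_ball
    {g G' : EuclideanSpace ℝ (Fin m) → EuclideanSpace ℝ (Fin m) →L[ℝ] EuclideanSpace ℝ (Fin m)}
    {w : EuclideanSpace ℝ (Fin m) → ℝ} {G : EuclideanSpace ℝ (Fin m) → EuclideanSpace ℝ (Fin m)}
    {y c : EuclideanSpace ℝ (Fin m)} {C : ℝ} (hg : ContinuousAt g y)
    (hpsd : ∀ᶠ x in 𝓝 y, ∀ S : EuclideanSpace ℝ (Fin m) →L[ℝ] EuclideanSpace ℝ (Fin m),
      (∀ ξ, 0 ≤ ⟪S ξ, ξ⟫) → 0 ≤ traceCLM m ((g x).comp S))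
    (hw : ∀ᶠ x in 𝓝 y, 0 ≤ w x) (hwG : ∀ᶠ x in 𝓝 y, HasGradientAt w (G x) x)
    (hG' : ∀ᶠ x in 𝓝 y, HasFDerivAt G (G' x) x)
    (hineq : ∀ᶠ x in 𝓝 y, traceCLM m ((g x).comp (G' x)) ≤ C * ‖G x‖)
    (hy : w y = 0) (hball : ∀ x ∈ ball c ‖y - c‖, 0 < w x) :
    ⟪y - c, g y (y - c)⟫ ≤ 0 := by
  have hyc : y - midpoint ℝ c y = (2⁻¹ : ℝ) • (y - c) := by
    rw [midpoint_eq_smul_add, invOf_eq_inv]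
    module
  -- The ball of half the radius, internally tangent at `y`, has its closure inside the original
  -- open ball except for `y` itself.
  have key := inner_nonpos_of_touching_closedBall (c := midpoint ℝ c y) hg hpsd hw hwG hG' hineq hy
    (fun x hx hxy => hball x ?_)
  · rw [hyc, map_smul, inner_smul_left, inner_smul_right] at key
    simp only [conj_trivial] at key
    linarith
  · rw [mem_closedBall, dist_eq_norm, hyc, norm_smul] at hx
    rw [mem_ball, dist_eq_norm]
    set p := x - midpoint ℝ c y with hp
    set q := (2⁻¹ : ℝ) • (y - c) with hq
    have h1 : x - c = p + q := by
      rw [hp, hq, midpoint_eq_smul_add, invOf_eq_inv]; module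
    have h2 : ‖y - c‖ = 2 * ‖q‖ := by rw [hq, norm_smul, Real.norm_eq_abs, abs_of_pos (by norm_num)]; ring
    have h3 : ‖p‖ ≤ ‖q‖ := by rwa [← norm_smul] at hx
    have hpq : p ≠ q := by
      intro h
      apply hxy
      have h4 : x - y = p - q := by
        rw [hp, hq, midpoint_eq_smul_add, invOf_eq_inv]; module
      rw [h, sub_self] at h4
      exact sub_eq_zero.1 h4
    have h5 := parallelogram_law_with_norm ℝ p q
    have h6 : 0 < ‖p - q‖ := norm_pos_iff.2 (sub_ne_zero.2 hpq)
    rw [h1, h2]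
    apply lt_of_pow_lt_pow_left₀ 2 (by positivity)
    nlinarith [norm_nonneg p]

end Barrier

/-! ### Local flows and Bony's invariance theorem. -/

section Flow

variable {E : Type*} [NormedAddCommGroup E]

/-- Near `y`, integral curves of `X` that start in `Z` exist for a uniform time and remain
in `Z`. -/
def LocallyFlowInvariant [NormedSpace ℝ E] (Z : Set E) (X : E → E) (y : E) : Prop :=
  ∀ δ > 0, ∃ ε > 0, ∀ q ∈ Z ∩ closedBall y ε, ∃ γ : ℝ → E, γ 0 = q ∧
    ∀ t ∈ Icc 0 ε, γ t ∈ Z ∧ γ t ∈ ball y δ ∧ HasDerivWithinAt γ (X (γ t)) (Icc 0 ε) t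

/-- The Picard–Lindelöf flow is Lipschitz in the initial point, so one `ε` serves all starts: `δ /
2` is spent on the curve from `y` and `δ / 2` on the distance to it. -/
lemma exists_local_flow [NormedSpace ℝ E] [CompleteSpace E] {X : E → E} {y : E}
    (hX : ContDiffAt ℝ 1 X y) {δ : ℝ} (hδ : 0 < δ) :
    ∃ ε > 0, ∀ q ∈ closedBall y ε, ∃ γ : ℝ → E, γ 0 = q ∧
      ∀ t ∈ Icc 0 ε, γ t ∈ ball y δ ∧ HasDerivWithinAt γ (X (γ t)) (Icc 0 ε) t := by
  obtain ⟨ε, hε, a, r, L, K, hr, hpl⟩ := IsPicardLindelof.of_contDiffAt_one hX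
  obtain ⟨α, hα, L', hL'⟩ :=
    (hpl 0).exists_forall_mem_closedBall_eq_hasDerivWithinAt_lipschitzOnWith
  simp only [zero_sub, zero_add] at hα hL'
  have hr' : (0 : ℝ) < r := hr
  have hy : y ∈ closedBall y (r : ℝ) := mem_closedBall_self hr'.le
  have h0 : (0 : ℝ) ∈ Icc (-ε) ε := ⟨by linarith, hε.le⟩
  have hcont : ContinuousAt (α y) 0 :=
    ((hα y hy).2 0 h0).continuousWithinAt.continuousAt (Icc_mem_nhds (by linarith) hε)
  obtain ⟨τ, hτ, hτball⟩ := Metric.continuousAt_iff.1 hcont (δ / 2) (by linarith)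
  set ε' := min (min ε r) (min (τ / 2) (δ / 2 / (L' + 1) / 2)) with hε'
  have h1 : ε' ≤ ε := (min_le_left _ _).trans (min_le_left _ _)
  have h2 : ε' ≤ r := (min_le_left _ _).trans (min_le_right _ _)
  have h3 : ε' ≤ τ / 2 := (min_le_right _ _).trans (min_le_left _ _)
  have h4 : ε' ≤ δ / 2 / (L' + 1) / 2 := (min_le_right _ _).trans (min_le_right _ _)
  have hε'0 : 0 < ε' := by positivity
  refine ⟨ε', hε'0, fun q hq => ?_⟩
  have hqr : q ∈ closedBall y (r : ℝ) := closedBall_subset_closedBall h2 hq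
  refine ⟨α q, (hα q hqr).1, fun t ht => ?_⟩
  have htI : t ∈ Icc (-ε) ε := ⟨by linarith [ht.1], ht.2.trans h1⟩
  refine ⟨?_, ((hα q hqr).2 t htI).mono (Icc_subset_Icc (by linarith) h1)⟩
  have h5 : dist (α q t) (α y t) ≤ L' * dist q y := (hL' t htI).dist_le_mul q hqr y hy
  have h6 : dist (α y t) y < δ / 2 := by
    have := hτball (x := t) (by rw [Real.dist_eq, sub_zero, abs_of_nonneg ht.1]; linarith [ht.2])
    rwa [(hα y hy).1] at this
  have h7 : L' * dist q y ≤ δ / 2 := by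
    have h8 : dist q y ≤ δ / 2 / (L' + 1) := by
      have : 0 < δ / 2 / ((L' : ℝ) + 1) := by positivity
      linarith [mem_closedBall.1 hq]
    calc (L' : ℝ) * dist q y ≤ (L' + 1) * (δ / 2 / (L' + 1)) := by gcongr; linarith
      _ = δ / 2 := by field_simp
  rw [mem_ball]
  linarith [dist_triangle (α q t) (α y t) y]

/-- Bony's theorem: if `X` is orthogonal to all the normals of touching balls of `Z`, then `Z` is
invariant under the flow of `X`. -/
lemma mem_of_integralCurve_of_inner_normal_eq_zero [InnerProductSpace ℝ E] [ProperSpace E]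
    {Z : Set E} {X : E → E} {y : E} {R : ℝ} {k : NNReal} (hy : y ∈ Z) (hR : 0 < R)
    (hZ : IsClosed (Z ∩ closedBall y (2 * R))) (hX : LipschitzOnWith k X (ball y (2 * R)))
    (hnormal : ∀ p ∈ Z ∩ ball y (2 * R), ∀ q, ball q ‖p - q‖ ⊆ ball y (2 * R) →
      Disjoint (ball q ‖p - q‖) Z → ⟪p - q, X p⟫ = 0)
    {γ : ℝ → E} {T : ℝ} (h0 : γ 0 ∈ Z) (hball : ∀ t ∈ Icc 0 T, γ t ∈ ball y R)
    (hγ : ∀ t ∈ Icc 0 T, HasDerivWithinAt γ (X (γ t)) (Icc 0 T) t) :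
    ∀ t ∈ Icc 0 T, γ t ∈ Z := by
  -- Truncation gives compactness. Since `γ` stays within `R` of `y ∈ K`, its nearest points in `K`
  -- lie in the open ball of radius `2 * R`.
  set K := Z ∩ closedBall y (2 * R) with hK
  have hKc : IsCompact K :=
    (isCompact_closedBall y (2 * R)).of_isClosed_subset hZ inter_subset_right
  have hyK : y ∈ K := ⟨hy, mem_closedBall_self (by linarith)⟩
  have hγc : ContinuousOn γ (Icc 0 T) := fun t ht => (hγ t ht).continuousWithinAt
  have hfc : ContinuousOn (fun t => infDist (γ t) K ^ 2) (Icc 0 T) :=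
    ((continuous_infDist_pt K).comp_continuousOn hγc).pow 2
  intro t ht
  have hT : (0 : ℝ) ≤ T := ht.1.trans ht.2
  have h0K : γ 0 ∈ K := ⟨h0, closedBall_subset_closedBall (by linarith)
    (ball_subset_closedBall (hball 0 ⟨le_rfl, hT⟩))⟩
  -- Grönwall for the squared distance to `K`, which vanishes at time `0`. At time `s` it is bounded
  -- above by the squared distance to a fixed nearest point `p`, with equality at `s`.
  have key := le_gronwallBound_of_liminf_deriv_right_le (f' := fun t => 2 * k * infDist (γ t) K ^ 2)
    (δ := 0) (K := 2 * k) (ε := 0) hfc ?_ (by simp [infDist_zero_of_mem h0K])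
    (fun _ _ => by simp) t ht
  · rw [gronwallBound_ε0_δ0] at key
    have h1 : infDist (γ t) K = 0 := by
      have := sq_nonneg (infDist (γ t) K)
      exact pow_eq_zero_iff (two_ne_zero) |>.1 (le_antisymm key this)
    exact ((hZ.mem_iff_infDist_zero ⟨y, hyK⟩).2 h1).1
  · intro s hs r hr
    have hsI : s ∈ Icc 0 T := ⟨hs.1, hs.2.le⟩
    obtain ⟨p, hpK, hp⟩ := hKc.exists_infDist_eq_dist ⟨y, hyK⟩ (γ s)
    have hsy : dist (γ s) y < R := hball s hsI
    have hps : dist (γ s) p < R := by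
      rw [← hp]; exact (infDist_le_dist_of_mem hyK).trans_lt hsy
    have hpball : p ∈ ball y (2 * R) := by
      rw [mem_ball]
      linarith [dist_triangle p (γ s) y, dist_comm p (γ s)]
    have hps' : ‖p - γ s‖ = dist (γ s) p := by rw [dist_comm, dist_eq_norm]
    have hsub : ball (γ s) ‖p - γ s‖ ⊆ ball y (2 * R) := by
      intro x hx
      rw [mem_ball] at hx ⊢
      linarith [dist_triangle x (γ s) y]
    have horth : ⟪p - γ s, X p⟫ = 0 := by
      refine hnormal p ⟨hpK.1, hpball⟩ (γ s) hsub ?_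
      rw [Set.disjoint_left]
      intro x hx hxZ
      have h1 : infDist (γ s) K ≤ dist (γ s) x :=
        infDist_le_dist_of_mem ⟨hxZ, ball_subset_closedBall (hsub hx)⟩
      rw [mem_ball, dist_comm] at hx
      linarith
    set φ : ℝ → ℝ := fun z => ‖γ z - p‖ ^ 2 with hφ
    have hd : HasDerivWithinAt φ (2 * ⟪γ s - p, X (γ s)⟫) (Ioi s) s := by
      have h1 : HasDerivWithinAt γ (X (γ s)) (Ioi s) s :=
        (hγ s hsI).mono_of_mem_nhdsWithin
          (mem_of_superset (Ioc_mem_nhdsGT hs.2) fun x hx => ⟨hs.1.trans hx.1.le, hx.2⟩)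
      exact (h1.sub_const p).norm_sq
    have hle : 2 * ⟪γ s - p, X (γ s)⟫ ≤ 2 * k * infDist (γ s) K ^ 2 := by
      -- Orthogonality at `p` permits subtracting `X p`; the Lipschitz bound then yields a squared
      -- distance.
      have h1 : ⟪γ s - p, X (γ s)⟫ = ⟪γ s - p, X (γ s) - X p⟫ := by
        rw [inner_sub_right, ← neg_sub p (γ s), inner_neg_left, inner_neg_left, horth]
        ring
      have h2 : ⟪γ s - p, X (γ s) - X p⟫ ≤ ‖γ s - p‖ * (k * ‖γ s - p‖) :=
        (real_inner_le_norm _ _).trans (by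
          gcongr
          exact hX.norm_sub_le (ball_subset_ball (by linarith) (hball s hsI)) hpball)
      rw [h1, hp, dist_eq_norm]
      linarith
    have hslope := (hasDerivWithinAt_iff_tendsto_slope' (by simp)).1 hd
    have hev := hslope.eventually_lt_const (hle.trans_lt hr)
    refine Eventually.frequently ?_
    filter_upwards [hev, self_mem_nhdsWithin] with z hz hzs
    refine lt_of_le_of_lt ?_ hz
    rw [slope_def_field, div_eq_inv_mul]
    have hzs' : 0 < z - s := sub_pos.2 hzs
    gcongr
    · have h1 : infDist (γ z) K ≤ ‖γ z - p‖ := by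
        rw [← dist_eq_norm]; exact infDist_le_dist_of_mem hpK
      exact pow_le_pow_left₀ infDist_nonneg h1 2
    · rw [hp, dist_eq_norm]

lemma locallyFlowInvariant_of_inner_normal_eq_zero [InnerProductSpace ℝ E] [ProperSpace E]
    {Z : Set E} {X : E → E} {y : E} {R : ℝ} (hy : y ∈ Z) (hR : 0 < R)
    (hZ : IsClosed (Z ∩ closedBall y R)) (hX : ContDiffAt ℝ 1 X y)
    (hnormal : ∀ p ∈ Z ∩ ball y R, ∀ q, ball q ‖p - q‖ ⊆ ball y R →
      Disjoint (ball q ‖p - q‖) Z → ⟪p - q, X p⟫ = 0) :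
    LocallyFlowInvariant Z X y := by
  intro δ hδ
  obtain ⟨k, s, hs, hk⟩ := hX.exists_lipschitzOnWith
  obtain ⟨ρ, hρ, hρs⟩ := Metric.mem_nhds_iff.1 hs
  set R' := min ρ R / 2 with hR'
  have hR'0 : 0 < R' := by positivity
  have h1 : 2 * R' ≤ ρ := by have := min_le_left ρ R; linarith
  have h2 : 2 * R' ≤ R := by have := min_le_right ρ R; linarith
  have hZ' : IsClosed (Z ∩ closedBall y (2 * R')) := by
    have : Z ∩ closedBall y (2 * R') = Z ∩ closedBall y R ∩ closedBall y (2 * R') := by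
      rw [inter_assoc, inter_eq_right.2 (closedBall_subset_closedBall h2)]
    rw [this]
    exact hZ.inter isClosed_closedBall
  obtain ⟨ε, hε, hflow⟩ := exists_local_flow hX (lt_min hδ hR'0)
  refine ⟨ε, hε, fun q hq => ?_⟩
  obtain ⟨γ, hγ0, hγ⟩ := hflow q hq.2
  refine ⟨γ, hγ0, fun t ht => ⟨?_, ball_subset_ball (min_le_left _ _) (hγ t ht).1, (hγ t ht).2⟩⟩
  exact mem_of_integralCurve_of_inner_normal_eq_zero hy hR'0 hZ'
    (hk.mono ((ball_subset_ball h1).trans hρs))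
    (fun p hp q hq hd => hnormal p ⟨hp.1, ball_subset_ball h2 hp.2⟩ q
      (hq.trans (ball_subset_ball h2)) hd)
    (by rw [hγ0]; exact hq.1) (fun t ht => ball_subset_ball (min_le_right _ _) (hγ t ht).1)
    (fun t ht => (hγ t ht).2) t ht

end Flow

/-! ### Second-order expansion of commutators of flows. -/

section Commutator

variable {E : Type*} [NormedAddCommGroup E] [NormedSpace ℝ E]

/-- Second-order Taylor expansion of integral curves, uniform in the initial point. -/
lemma norm_integralCurve_sub_le {X : E → E} {X' : E →L[ℝ] E} {y : E}
    (hX : HasStrictFDerivAt X X' y) {M δ : ℝ} (hM : ∀ x ∈ ball y δ, ‖X x‖ ≤ M) {η : ℝ}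
    (hη : 0 < η) :
    ∃ ρ > 0, ∀ q ∈ ball y ρ, ∀ t, 0 ≤ t → t < ρ → ∀ γ : ℝ → E, γ 0 = q →
      (∀ s ∈ Icc 0 t, γ s ∈ ball y δ ∧ HasDerivWithinAt γ (X (γ s)) (Icc 0 t) s) →
      ‖γ t - q - t • X q - (t ^ 2 / 2) • X' (X y)‖ ≤ η * t ^ 2 := by
  set M' := max M 0 with hM'
  have hM'0 : 0 ≤ M' := le_max_right _ _
  set θ := η / (M' + ‖X'‖ + 1) with hθ
  have hθ0 : 0 < θ := by positivity
  have hθη : θ * (M' + ‖X'‖) ≤ η := by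
    rw [hθ, div_mul_eq_mul_div, div_le_iff₀ (by positivity)]
    nlinarith [norm_nonneg X']
  -- Strict differentiability compares `X` at two points near `y`, which makes the estimate uniform
  -- in the starting point.
  have h1 : ∀ᶠ p : E × E in 𝓝 (y, y), ‖X p.1 - X p.2 - X' (p.1 - p.2)‖ ≤ θ * ‖p.1 - p.2‖ :=
    hX.isLittleO.def hθ0
  have h2 : ∀ᶠ x in 𝓝 y, ‖X x - X y‖ ≤ θ := by
    have := hX.continuousAt.tendsto.eventually (Metric.closedBall_mem_nhds (X y) hθ0)
    simpa [dist_eq_norm] using this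
  obtain ⟨ρ1, hρ1, hstrict⟩ := Metric.eventually_nhds_iff_ball.1 h1
  obtain ⟨ρ2, hρ2, hcont⟩ := Metric.eventually_nhds_iff_ball.1 h2
  set ρ0 := min ρ1 ρ2 with hρ0
  have hρ0pos : 0 < ρ0 := lt_min hρ1 hρ2
  -- Initial distance plus travel at speed `M'` is at most `ρ0 / 2`.
  refine ⟨ρ0 / (M' + 1) / 2, by positivity, fun q hq t ht0 ht γ hγ0 hγ => ?_⟩
  have hdiv : ρ0 / (M' + 1) ≤ ρ0 := div_le_self hρ0pos.le (by linarith)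
  have hline (s : ℝ) : HasDerivWithinAt (fun z : ℝ => z • X y) (X y) (Icc 0 t) s := by
    simpa using ((hasDerivAt_id s).smul_const (X y)).hasDerivWithinAt
  have hspeed : ∀ s ∈ Icc 0 t, ‖γ s - q‖ ≤ M' * s := by
    intro s hs
    have := norm_image_sub_le_of_norm_deriv_le_segment' (fun s hs => (hγ s hs).2)
      (fun s hs => (hM _ (hγ s ⟨hs.1, hs.2.le⟩).1).trans (le_max_left M 0)) s hs
    rwa [hγ0, sub_zero] at this
  have hclose : ∀ s ∈ Icc 0 t, γ s ∈ ball y ρ0 := by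
    intro s hs
    have h3 : M' * s ≤ M' * (ρ0 / (M' + 1) / 2) := by gcongr; linarith [hs.2]
    have h4 : (M' + 1) * (ρ0 / (M' + 1)) = ρ0 := by field_simp
    rw [mem_ball] at hq ⊢
    have h5 := dist_triangle (γ s) q y
    rw [dist_eq_norm (γ s) q] at h5
    linarith [hspeed s hs]
  have hqclose : q ∈ ball y ρ0 := by simpa [hγ0] using hclose 0 ⟨le_rfl, ht0⟩
  have hfirst : ∀ s ∈ Icc 0 t, ‖γ s - q - s • X y‖ ≤ θ * s := by
    intro s hs
    have := norm_image_sub_le_of_norm_deriv_le_segment' (f := fun z => γ z - z • X y) (C := θ)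
      (fun s hs => (hγ s hs).2.sub (hline s))
      (fun s hs => hcont _ (ball_subset_ball (min_le_right _ _) (hclose s ⟨hs.1, hs.2.le⟩))) s hs
    rw [hγ0, sub_zero, zero_smul, sub_zero] at this
    rwa [sub_right_comm]
  have hd : ∀ s ∈ Icc 0 t,
      HasDerivWithinAt (fun z => γ z - z • X q - (z ^ 2 / 2) • X' (X y))
        (X (γ s) - X q - s • X' (X y)) (Icc 0 t) s := by
    intro s hs
    have h3 : HasDerivWithinAt (fun z : ℝ => z • X q) (X q) (Icc 0 t) s := by
      simpa using ((hasDerivAt_id s).smul_const (X q)).hasDerivWithinAt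
    have h4 : HasDerivWithinAt (fun z : ℝ => (z ^ 2 / 2) • X' (X y)) (s • X' (X y)) (Icc 0 t) s := by
      have h5 : HasDerivAt (fun z : ℝ => z ^ 2 / 2) s s := by
        simpa using ((hasDerivAt_id s).pow 2).div_const 2
      exact (h5.smul_const _).hasDerivWithinAt
    exact ((hγ s hs).2.sub h3).sub h4
  have hbound : ∀ s ∈ Ico 0 t, ‖X (γ s) - X q - s • X' (X y)‖ ≤ η * t := by
    intro s hs
    have hsI : s ∈ Icc 0 t := ⟨hs.1, hs.2.le⟩
    have h3 : ‖X (γ s) - X q - X' (γ s - q)‖ ≤ θ * ‖γ s - q‖ := by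
      refine hstrict (γ s, q) ?_
      rw [← ball_prod_same]
      exact ⟨ball_subset_ball (min_le_left _ _) (hclose s hsI),
        ball_subset_ball (min_le_left _ _) hqclose⟩
    have h4 : ‖X' (γ s - q - s • X y)‖ ≤ ‖X'‖ * (θ * s) :=
      X'.le_opNorm_of_le (hfirst s hsI)
    have h5 : X (γ s) - X q - s • X' (X y)
        = (X (γ s) - X q - X' (γ s - q)) + X' (γ s - q - s • X y) := by
      simp only [map_sub, map_smul]
      abel
    calc ‖X (γ s) - X q - s • X' (X y)‖ ≤ θ * ‖γ s - q‖ + ‖X'‖ * (θ * s) := by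
          rw [h5]; exact (norm_add_le _ _).trans (add_le_add h3 h4)
      _ ≤ θ * (M' * s) + ‖X'‖ * (θ * s) := by gcongr; exact hspeed s hsI
      _ = θ * (M' + ‖X'‖) * s := by ring
      _ ≤ η * t := by
        have := hs.2
        have := hs.1
        gcongr
  have := norm_image_sub_le_of_norm_deriv_le_segment' hd hbound t ⟨ht0, le_rfl⟩
  simp only [hγ0] at this
  calc ‖γ t - q - t • X q - (t ^ 2 / 2) • X' (X y)‖
      = ‖γ t - t • X q - (t ^ 2 / 2) • X' (X y) - (q - (0 : ℝ) • X q
        - ((0 : ℝ) ^ 2 / 2) • X' (X y))‖ := by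
        congr 1
        simp
        abel
    _ ≤ η * t * (t - 0) := this
    _ = η * t ^ 2 := by ring

/-- Flowing a second-order curve in `Z` for time `t` along `X` gives another such curve. -/
lemma LocallyFlowInvariant.exists_flowed_curve {Z : Set E} {X : E → E} {X' : E →L[ℝ] E} {y : E}
    (hinv : LocallyFlowInvariant Z X y) (hX : HasStrictFDerivAt X X' y) {q : ℝ → E} {q₁ q₂ : E}
    (hq : (fun t => q t - (y + t • q₁ + t ^ 2 • q₂)) =o[𝓝[>] 0] fun t : ℝ => t ^ 2)
    (hqZ : ∀ᶠ t in 𝓝[>] 0, q t ∈ Z) :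
    ∃ q' : ℝ → E, (∀ᶠ t in 𝓝[>] 0, q' t ∈ Z) ∧
      (fun t => q' t - (y + t • (q₁ + X y) + t ^ 2 • (q₂ + X' q₁ + (2⁻¹ : ℝ) • X' (X y))))
        =o[𝓝[>] 0] fun t : ℝ => t ^ 2 := by
  obtain ⟨δ, hδ, hM⟩ : ∃ δ > 0, ∀ x ∈ ball y δ, ‖X x‖ ≤ ‖X y‖ + 1 := by
    refine Metric.eventually_nhds_iff_ball.1 ?_
    filter_upwards [hX.continuousAt.norm.tendsto.eventually_lt_const (lt_add_one ‖X y‖)] with x hx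
      using hx.le
  obtain ⟨ε, hε, hflow⟩ := hinv δ hδ
  have hid : Tendsto (fun t : ℝ => t) (𝓝[>] 0) (𝓝 0) := tendsto_nhdsWithin_of_tendsto_nhds tendsto_id
  have hsq : (fun t : ℝ => t ^ 2) =o[𝓝[>] 0] fun t : ℝ => t := by
    have := (isLittleO_pow_id (𝕜 := ℝ) one_lt_two).mono (nhdsWithin_le_nhds (s := Ioi 0))
    simpa using this
  have hlin : (fun t => q t - y - t • q₁) =o[𝓝[>] 0] fun t : ℝ => t := by
    have h1 : (fun t : ℝ => t ^ 2 • q₂) =o[𝓝[>] 0] fun t : ℝ => t := by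
      refine IsBigO.trans_isLittleO ?_ hsq
      exact IsBigO.of_bound ‖q₂‖ (Eventually.of_forall fun t => by rw [norm_smul, mul_comm])
    refine ((hq.trans hsq).add h1).congr_left fun t => ?_
    abel
  have hbig : (fun t => q t - y) =O[𝓝[>] 0] fun t : ℝ => t := by
    have h1 : (fun t : ℝ => t • q₁) =O[𝓝[>] 0] fun t : ℝ => t :=
      IsBigO.of_bound ‖q₁‖ (Eventually.of_forall fun t => by rw [norm_smul, mul_comm])
    refine (hlin.isBigO.add h1).congr_left fun t => ?_
    abel
  have hqy : Tendsto q (𝓝[>] 0) (𝓝 y) :=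
    tendsto_sub_nhds_zero_iff.1 (hbig.trans_tendsto hid)
  have hXq : (fun t => X (q t) - X y - t • X' q₁) =o[𝓝[>] 0] fun t : ℝ => t := by
    have h1 := (hX.hasFDerivAt.isLittleO.comp_tendsto hqy).trans_isBigO hbig
    have h2 : (fun t => X' (q t - y - t • q₁)) =o[𝓝[>] 0] fun t : ℝ => t :=
      (X'.isBigO_comp _ _).trans_isLittleO hlin
    refine (h1.add h2).congr_left fun t => ?_
    simp only [Function.comp, map_sub, map_smul]
    abel
  have htXq : (fun t => t • (X (q t) - X y - t • X' q₁)) =o[𝓝[>] 0] fun t : ℝ => t ^ 2 := by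
    have := (isBigO_refl (fun t : ℝ => t) (𝓝[>] 0)).smul_isLittleO hXq
    simpa [sq] using this
  have hqε : ∀ᶠ t in 𝓝[>] 0, q t ∈ closedBall y ε := hqy.eventually (closedBall_mem_nhds y hε)
  choose! γ hγ0 hγ using hflow
  have htε : ∀ᶠ t in 𝓝[>] (0 : ℝ), t ∈ Icc 0 ε :=
    mem_of_superset (Ioc_mem_nhdsGT hε) fun x hx => ⟨hx.1.le, hx.2⟩
  refine ⟨fun t => γ (q t) t, ?_, ?_⟩
  · filter_upwards [hqZ, hqε, htε] with t h1 h2 h3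
    exact (hγ (q t) ⟨h1, h2⟩ t h3).1
  -- The starting point `q t` moves with `t`, hence the need for a uniform Taylor estimate.
  · have hexp : (fun t => γ (q t) t - q t - t • X (q t) - (t ^ 2 / 2) • X' (X y))
        =o[𝓝[>] 0] fun t : ℝ => t ^ 2 := by
      refine IsLittleO.of_bound fun η hη => ?_
      obtain ⟨ρ, hρ, hest⟩ := norm_integralCurve_sub_le hX hM hη
      have htρ : ∀ᶠ t in 𝓝[>] (0 : ℝ), t < ρ := hid.eventually_lt_const hρ
      filter_upwards [hqZ, hqε, htε, htρ, hqy.eventually (ball_mem_nhds y hρ)]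
        with t h1 h2 h3 h4 h5
      rw [Real.norm_eq_abs, abs_of_nonneg (sq_nonneg t)]
      refine hest (q t) h5 t h3.1 h4 _ (hγ0 _ ⟨h1, h2⟩) fun s hs => ?_
      obtain ⟨-, h6, h7⟩ := hγ (q t) ⟨h1, h2⟩ s ⟨hs.1, hs.2.trans h3.2⟩
      exact ⟨h6, h7.mono (Icc_subset_Icc_right h3.2)⟩
    refine ((hexp.add htXq).add hq).congr_left fun t => ?_
    module

/-- A set invariant under the flows of `±X` and `±Y` contains, to second order, the curve
`t ↦ y + t² [X, Y](y)`. -/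
lemma exists_commutator_curve {Z : Set E} {X Y : E → E} {X' Y' : E →L[ℝ] E} {y : E} (hy : y ∈ Z)
    (hX : HasStrictFDerivAt X X' y) (hY : HasStrictFDerivAt Y Y' y)
    (hXZ : LocallyFlowInvariant Z X y) (hYZ : LocallyFlowInvariant Z Y y)
    (hXZ' : LocallyFlowInvariant Z (-X) y) (hYZ' : LocallyFlowInvariant Z (-Y) y) :
    ∃ p : ℝ → E, (∀ᶠ t in 𝓝[>] 0, p t ∈ Z) ∧
      (fun t => p t - (y + t ^ 2 • (Y' (X y) - X' (Y y)))) =o[𝓝[>] 0] fun t : ℝ => t ^ 2 := by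
  -- Flow along `X`, `Y`, `-X`, `-Y` in turn: the linear terms cancel and `Y' (X y) - X' (Y y)`
  -- remains at order `t²`.
  obtain ⟨a, haZ, ha⟩ := hXZ.exists_flowed_curve hX (q := fun _ => y) (q₁ := 0) (q₂ := 0)
    (by simp) (Eventually.of_forall fun _ => hy)
  obtain ⟨b, hbZ, hb⟩ := hYZ.exists_flowed_curve hY ha haZ
  obtain ⟨c, hcZ, hc⟩ := hXZ'.exists_flowed_curve hX.neg hb hbZ
  obtain ⟨d, hdZ, hd⟩ := hYZ'.exists_flowed_curve hY.neg hc hcZ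
  refine ⟨d, hdZ, hd.congr_left fun t => ?_⟩
  simp only [map_zero, map_add, map_neg, Pi.neg_apply, neg_apply]
  module

end Commutator

/-! ### From curvature comparison to normals of the contact set. -/

section Curvature

variable {m : ℕ} {U : Set (EuclideanSpace ℝ (Fin m))} {u v : EuclideanSpace ℝ (Fin m) → ℝ}
  {F : EuclideanSpace ℝ (Fin m) → EuclideanSpace ℝ (Fin m)}

lemma ContDiffAt.gradient {E : Type*} [NormedAddCommGroup E] [InnerProductSpace ℝ E]
    [CompleteSpace E] {u : E → ℝ} {x : E} (hu : ContDiffAt ℝ 2 u x) :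
    ContDiffAt ℝ 1 (gradient u) x :=
  ((InnerProductSpace.toDual ℝ E).symm.contDiff.contDiffAt (n := 1)).comp x
    (hu.fderiv_right (m := 1) (by norm_num))

lemma horizontalMeanCurvature_eq_traceCLM {x : EuclideanSpace ℝ (Fin m)}
    (hd : DifferentiableAt ℝ (fun x => gradient u x + F x) x) (h0 : gradient u x + F x ≠ 0) :
    horizontalMeanCurvature F u x = traceCLM m
      ((fderiv ℝ unitMap (gradient u x + F x)).comp (fderiv ℝ (fun x => gradient u x + F x) x)) := by
  rw [horizontalMeanCurvature, divergence_eq_traceCLM]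
  congr 1
  exact fderiv_comp x ((contDiffAt_unitMap (n := 1) h0).differentiableAt (by simp)) hd

lemma norm_unitMap {E : Type*} [NormedAddCommGroup E] [InnerProductSpace ℝ E] {p : E}
    (hp : p ≠ 0) : ‖unitMap p‖ = 1 := by
  rw [unitMap, norm_smul, norm_inv, norm_norm, inv_mul_cancel₀ (norm_ne_zero_iff.2 hp)]

/-- The comparison of curvatures as a linear differential inequality for `u - v`, near a point
where the gradients agree. -/
lemma exists_traceCLM_le_mul_norm (hU : IsOpen U) (hu : ContDiffOn ℝ 2 u U)
    (hv : ContDiffOn ℝ 2 v U) (hF : ContDiff ℝ 1 F) (hu0 : ∀ x ∈ U, gradient u x + F x ≠ 0)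
    (hv0 : ∀ x ∈ U, gradient v x + F x ≠ 0)
    (hH : ∀ x ∈ U, horizontalMeanCurvature F u x ≤ horizontalMeanCurvature F v x)
    {p : EuclideanSpace ℝ (Fin m)} (hp : p ∈ U) (hgrad : gradient u p = gradient v p) :
    ∃ C : ℝ, ∀ᶠ x in 𝓝 p, traceCLM m ((fderiv ℝ unitMap (gradient u x + F x)).comp
      (fderiv ℝ (gradient u) x - fderiv ℝ (gradient v) x)) ≤ C * ‖gradient u x - gradient v x‖ := by
  have hgu (x) (hx : x ∈ U) : ContDiffAt ℝ 1 (gradient u) x :=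
    (hu.contDiffAt (hU.mem_nhds hx)).gradient
  have hgv (x) (hx : x ∈ U) : ContDiffAt ℝ 1 (gradient v) x :=
    (hv.contDiffAt (hU.mem_nhds hx)).gradient
  have hau (x) (hx : x ∈ U) : ContDiffAt ℝ 1 (fun x => gradient u x + F x) x :=
    (hgu x hx).add hF.contDiffAt
  have hav (x) (hx : x ∈ U) : ContDiffAt ℝ 1 (fun x => gradient v x + F x) x :=
    (hgv x hx).add hF.contDiffAt
  have hν : ContDiffAt ℝ 1 (fderiv ℝ (unitMap (E := EuclideanSpace ℝ (Fin m))))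
      (gradient u p + F p) :=
    (contDiffAt_unitMap (n := 2) (hu0 p hp)).fderiv_right (by norm_num)
  obtain ⟨K, s, hs, hK⟩ := hν.exists_lipschitzOnWith
  have hsu : ∀ᶠ x in 𝓝 p, gradient u x + F x ∈ s := (hau p hp).continuousAt.eventually hs
  have hsv : ∀ᶠ x in 𝓝 p, gradient v x + F x ∈ s :=
    (hav p hp).continuousAt.eventually (by
      change s ∈ 𝓝 (gradient v p + F p)
      rwa [← hgrad])
  have hbd : ∀ᶠ x in 𝓝 p, ‖fderiv ℝ (fun x => gradient v x + F x) x‖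
      ≤ ‖fderiv ℝ (fun x => gradient v x + F x) p‖ + 1 := by
    have hc : ContinuousAt (fderiv ℝ (fun x => gradient v x + F x)) p :=
      ((hav p hp).fderiv_right (m := 0) (by norm_num)).continuousAt
    filter_upwards [hc.norm.tendsto.eventually_lt_const (lt_add_one _)] with x hx using hx.le
  set B := ‖fderiv ℝ (fun x => gradient v x + F x) p‖ + 1 with hB
  refine ⟨‖traceCLM m‖ * (K * B), ?_⟩
  filter_upwards [hsu, hsv, hbd, hU.mem_nhds hp] with x h1 h2 h3 hx
  have hdu := (hau x hx).differentiableAt (by simp)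
  have hdv := (hav x hx).differentiableAt (by simp)
  have hH' := hH x hx
  rw [horizontalMeanCurvature_eq_traceCLM hdu (hu0 x hx),
    horizontalMeanCurvature_eq_traceCLM hdv (hv0 x hx)] at hH'
  set P := fderiv ℝ unitMap (gradient u x + F x) with hP
  set Q := fderiv ℝ unitMap (gradient v x + F x) with hQ
  set A := fderiv ℝ (fun x => gradient u x + F x) x with hA
  set A' := fderiv ℝ (fun x => gradient v x + F x) x with hA'
  have hAA' : fderiv ℝ (gradient u) x - fderiv ℝ (gradient v) x = A - A' := by
    have hFd : DifferentiableAt ℝ F x := hF.contDiffAt.differentiableAt (by simp)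
    rw [hA, hA', fderiv_fun_add ((hgu x hx).differentiableAt (by simp)) hFd,
      fderiv_fun_add ((hgv x hx).differentiableAt (by simp)) hFd]
    abel
  -- The curvature inequality is `tr (P A) ≤ tr (Q A')`. Subtracting `tr (P A')` leaves an error
  -- controlled by `Q - P`, hence by the difference of gradients.
  have h4 : traceCLM m (P.comp (A - A')) ≤ traceCLM m ((Q - P).comp A') := by
    rw [ContinuousLinearMap.comp_sub, ContinuousLinearMap.sub_comp, map_sub, map_sub]
    linarith
  have h5 : ‖Q - P‖ ≤ K * ‖gradient u x - gradient v x‖ := by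
    have := hK.norm_sub_le h2 h1
    rwa [add_sub_add_right_eq_sub, norm_sub_rev (gradient v x)] at this
  rw [hAA']
  calc traceCLM m (P.comp (A - A')) ≤ traceCLM m ((Q - P).comp A') := h4
    _ ≤ ‖traceCLM m ((Q - P).comp A')‖ := le_abs_self _
    _ ≤ ‖traceCLM m‖ * (‖Q - P‖ * ‖A'‖) :=
      (traceCLM m).le_opNorm_of_le (ContinuousLinearMap.opNorm_comp_le _ _)
    _ ≤ ‖traceCLM m‖ * ((K * ‖gradient u x - gradient v x‖) * B) := by gcongr
    _ = ‖traceCLM m‖ * (K * B) * ‖gradient u x - gradient v x‖ := by ring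

/-- A ball touching the contact set of `u ≥ v` from outside has its normal parallel to `∇u + F`. -/
lemma exists_eq_smul_of_touching_ball (hU : IsOpen U) (hu : ContDiffOn ℝ 2 u U)
    (hv : ContDiffOn ℝ 2 v U) (hF : ContDiff ℝ 1 F) (hu0 : ∀ x ∈ U, gradient u x + F x ≠ 0)
    (hv0 : ∀ x ∈ U, gradient v x + F x ≠ 0)
    (hH : ∀ x ∈ U, horizontalMeanCurvature F u x ≤ horizontalMeanCurvature F v x)
    (huv : ∀ x ∈ U, v x ≤ u x) {p q : EuclideanSpace ℝ (Fin m)}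
    (hp : p ∈ {x ∈ U | u x = v x}) (hball : ball q ‖p - q‖ ⊆ U)
    (hdisj : Disjoint (ball q ‖p - q‖) {x ∈ U | u x = v x}) :
    ∃ l : ℝ, p - q = l • (gradient u p + F p) := by
  have hUp : U ∈ 𝓝 p := hU.mem_nhds hp.1
  have hgu (x) (hx : x ∈ U) : ContDiffAt ℝ 1 (gradient u) x :=
    (hu.contDiffAt (hU.mem_nhds hx)).gradient
  have hgv (x) (hx : x ∈ U) : ContDiffAt ℝ 1 (gradient v) x :=
    (hv.contDiffAt (hU.mem_nhds hx)).gradient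
  have hwG (x) (hx : x ∈ U) :
      HasGradientAt (fun x => u x - v x) (gradient u x - gradient v x) x := by
    have h1 := ((hu.contDiffAt (hU.mem_nhds hx)).differentiableAt (by simp)).hasGradientAt
    have h2 := ((hv.contDiffAt (hU.mem_nhds hx)).differentiableAt (by simp)).hasGradientAt
    rw [hasGradientAt_iff_hasFDerivAt] at *
    rw [map_sub]
    exact h1.sub h2
  have hgrad : gradient u p = gradient v p := by
    have hmin : IsLocalMin (fun x => u x - v x) p := by
      filter_upwards [hUp] with x hx
      have := huv x hx
      have := hp.2
      linarith
    have h1 := hmin.fderiv_eq_zero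
    rw [(hwG p hp.1).hasFDerivAt.fderiv] at h1
    exact sub_eq_zero.1
      ((InnerProductSpace.toDual ℝ (EuclideanSpace ℝ (Fin m))).injective (h1.trans (map_zero _).symm))
  obtain ⟨C, hC⟩ := exists_traceCLM_le_mul_norm hU hu hv hF hu0 hv0 hH hp.1 hgrad
  have hcont : ContinuousAt (fun x => fderiv ℝ unitMap (gradient u x + F x)) p := by
    have h1 : ContinuousAt (fderiv ℝ (unitMap (E := EuclideanSpace ℝ (Fin m))))
        (gradient u p + F p) :=
      ((contDiffAt_unitMap (n := 1) (hu0 p hp.1)).fderiv_right (m := 0) (by norm_num)).continuousAt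
    have h2 : ContinuousAt (fun x => gradient u x + F x) p :=
      (hgu p hp.1).continuousAt.add hF.continuous.continuousAt
    exact ContinuousAt.comp (f := fun x => gradient u x + F x) h1 h2
  have key := inner_nonpos_of_touching_ball (w := fun x => u x - v x)
    (G := fun x => gradient u x - gradient v x)
    (G' := fun x => fderiv ℝ (gradient u) x - fderiv ℝ (gradient v) x) (c := q) (C := C) hcont
    (by
      filter_upwards [hUp] with x hx S hS
      exact traceCLM_comp_nonneg (inv_nonneg.2 (norm_nonneg _)) (norm_unitMap (hu0 x hx))
        (fderiv_unitMap (hu0 x hx)) hS)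
    (by filter_upwards [hUp] with x hx using sub_nonneg.2 (huv x hx))
    (by filter_upwards [hUp] with x hx using hwG x hx)
    (by
      filter_upwards [hUp] with x hx
      exact ((hgu x hx).differentiableAt (by simp)).hasFDerivAt.sub
        ((hgv x hx).differentiableAt (by simp)).hasFDerivAt)
    hC (sub_eq_zero.2 hp.2) (fun x hx => by
      refine sub_pos.2 (lt_of_le_of_ne (huv x (hball hx)) fun h => ?_)
      exact Set.disjoint_left.1 hdisj hx ⟨hball hx, h.symm⟩)
  have ha := hu0 p hp.1
  set a := gradient u p + F p with hadef
  set z := p - q with hz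
  clear_value z a
  rw [fderiv_unitMap ha, inner_smul_right] at key
  have h1 : ⟪z, z - ⟪unitMap a, z⟫ • unitMap a⟫ ≤ 0 :=
    nonpos_of_mul_nonpos_right key (inv_pos.2 (norm_pos_iff.2 ha))
  -- For an orthogonal projection `⟪z, P z⟫ = ‖P z‖²`, so nonpositivity kills the component of `z`
  -- orthogonal to `a`.
  have h2 : ‖z - ⟪unitMap a, z⟫ • unitMap a‖ ^ 2 = ⟪z, z - ⟪unitMap a, z⟫ • unitMap a⟫ := by
    rw [← real_inner_self_eq_norm_sq, inner_sub_left z, sub_eq_self, inner_smul_left,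
      inner_sub_right, inner_smul_right, real_inner_self_eq_norm_sq, norm_unitMap ha]
    simp
  have h3 : z - ⟪unitMap a, z⟫ • unitMap a = 0 := by
    have := sq_nonneg ‖z - ⟪unitMap a, z⟫ • unitMap a‖
    exact norm_eq_zero.1 (pow_eq_zero_iff two_ne_zero |>.1 (by linarith))
  exact ⟨⟪unitMap a, z⟫ * ‖a‖⁻¹, by rw [mul_smul]; exact sub_eq_zero.1 h3⟩

end Curvature

/-! ### Exterior touching balls. -/

section Touching

/-- A relatively closed proper subset of a connected open set admits an exterior touching ball. -/
lemma exists_touching_ball {E : Type*} [NormedAddCommGroup E] [ProperSpace E]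
    {U Z : Set E} (hU : IsOpen U) (hUc : IsPreconnected U) (hZU : Z ⊆ U) (hZne : Z.Nonempty)
    (hZ : closure Z ∩ U ⊆ Z) (hne : ¬ U ⊆ Z) :
    ∃ p ∈ Z, ∃ q, p ≠ q ∧ ball q ‖p - q‖ ⊆ U ∧ Disjoint (ball q ‖p - q‖) Z := by
  obtain ⟨y, hyZ, hy⟩ : ∃ y ∈ Z, y ∉ interior Z := by
    by_contra! h
    have heq : interior Z = Z := subset_antisymm interior_subset h
    refine hne (hUc.subset_of_closure_inter_subset (u := Z) (heq ▸ isOpen_interior) ?_ hZ)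
    exact hZne.imp fun x hx => ⟨hZU hx, hx⟩
  obtain ⟨R, hR, hRU⟩ := Metric.isOpen_iff.1 hU y (hZU hyZ)
  -- With `q` within `R / 3` of `y`, the ball about `q` reaching its nearest point of `K` stays in
  -- the ball of radius `2 * R / 3`, so it misses all of `Z`.
  obtain ⟨q, hq, hqZ⟩ : ∃ q ∈ ball y (R / 3), q ∉ Z := by
    by_contra! h
    exact hy (mem_interior_iff_mem_nhds.2 (mem_of_superset (ball_mem_nhds y (by positivity)) h))
  set K := Z ∩ closedBall y (2 * R / 3) with hK
  have hsub : closedBall y (2 * R / 3) ⊆ U := (closedBall_subset_ball (by linarith)).trans hRU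
  have hKeq : K = closure Z ∩ closedBall y (2 * R / 3) :=
    subset_antisymm (inter_subset_inter_left _ subset_closure)
      fun x hx => ⟨hZ ⟨hx.1, hsub hx.2⟩, hx.2⟩
  have hKc : IsCompact K := by
    rw [hKeq]
    exact (isCompact_closedBall _ _).inter_left isClosed_closure
  have hyK : y ∈ K := ⟨hyZ, mem_closedBall_self (by positivity)⟩
  obtain ⟨p, hpK, hp⟩ := hKc.exists_infDist_eq_dist ⟨y, hyK⟩ q
  rw [mem_ball] at hq
  have hpq : ‖p - q‖ = dist q p := by rw [dist_comm, dist_eq_norm]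
  have hlt : dist q p < R / 3 := by
    rw [← hp]; exact (infDist_le_dist_of_mem hyK).trans_lt hq
  have hball : ball q ‖p - q‖ ⊆ closedBall y (2 * R / 3) := by
    intro x hx
    rw [mem_ball] at hx
    rw [mem_closedBall]
    linarith [dist_triangle x q y]
  refine ⟨p, hpK.1, q, fun h => hqZ (h ▸ hpK.1), hball.trans hsub, ?_⟩
  rw [Set.disjoint_left]
  intro x hx hxZ
  have h1 : infDist q K ≤ dist q x := infDist_le_dist_of_mem ⟨hxZ, hball hx⟩
  rw [mem_ball, dist_comm] at hx
  linarith

/-- Otherwise `‖c t - q‖² = ‖p - q‖² - 2 t² ⟪q - p, β⟫ + o(t²)` puts the curve inside the ball for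
small `t`. -/
lemma inner_nonpos_of_curve_disjoint_ball {E : Type*} [NormedAddCommGroup E]
    [InnerProductSpace ℝ E] {Z : Set E} {p q β : E} {c : ℝ → E}
    (hc : (fun t => c t - (p + t ^ 2 • β)) =o[𝓝[>] 0] fun t : ℝ => t ^ 2)
    (hcZ : ∀ᶠ t in 𝓝[>] 0, c t ∈ Z) (hdisj : Disjoint (ball q ‖p - q‖) Z) :
    ⟪q - p, β⟫ ≤ 0 := by
  by_contra! hκ
  set κ := ⟪q - p, β⟫ with hκdef
  set r := ‖p - q‖ with hr
  set η := κ / (2 * (r + 1)) with hη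
  have hr0 : 0 ≤ r := norm_nonneg _
  have hη0 : 0 < η := by positivity
  have hrη : r * η ≤ κ / 2 := by
    have : (r + 1) * η = κ / 2 := by rw [hη]; field_simp
    linarith
  have hid : Tendsto (fun t : ℝ => (‖β‖ + η) ^ 2 * t ^ 2) (𝓝[>] 0) (𝓝 0) := by
    have : ContinuousAt (fun t : ℝ => (‖β‖ + η) ^ 2 * t ^ 2) 0 := by fun_prop
    simpa using this.tendsto.mono_left (nhdsWithin_le_nhds (s := Ioi 0))
  obtain ⟨t, h1, h2, h3, h4⟩ := ((hc.def hη0).and (hcZ.and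
    ((hid.eventually_lt_const hκ).and self_mem_nhdsWithin))).exists
  have ht : 0 < t := h4
  refine Set.disjoint_left.1 hdisj ?_ h2
  set e := c t - (p + t ^ 2 • β) with he
  rw [Real.norm_eq_abs, abs_of_pos (by positivity)] at h1
  have h5 : c t - q = (t ^ 2 • β + e) - (q - p) := by rw [he]; abel
  have h6 : ‖t ^ 2 • β + e‖ ≤ (‖β‖ + η) * t ^ 2 := by
    refine (norm_add_le _ _).trans ?_
    rw [norm_smul, Real.norm_eq_abs, abs_of_pos (by positivity)]
    linarith
  have h7 : ⟪t ^ 2 • β + e, q - p⟫ ≥ t ^ 2 * κ - r * (η * t ^ 2) := by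
    rw [inner_add_left, inner_smul_left, real_inner_comm]
    have h8 : -(‖e‖ * ‖q - p‖) ≤ ⟪e, q - p⟫ := (abs_le.1 (abs_real_inner_le_norm _ _)).1
    have h9 : ‖e‖ * ‖q - p‖ ≤ η * t ^ 2 * r := by
      rw [norm_sub_rev q p, ← hr]; gcongr
    simp only [conj_trivial]
    linarith
  rw [mem_ball, dist_eq_norm]
  refine lt_of_pow_lt_pow_left₀ 2 hr0 ?_
  rw [h5, norm_sub_sq_real, norm_sub_rev q p, ← hr]
  have h10 : ‖t ^ 2 • β + e‖ ^ 2 ≤ ((‖β‖ + η) * t ^ 2) ^ 2 := by gcongr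
  have h11 : ((‖β‖ + η) * t ^ 2) ^ 2 < κ * t ^ 2 := by
    calc ((‖β‖ + η) * t ^ 2) ^ 2 = ((‖β‖ + η) ^ 2 * t ^ 2) * t ^ 2 := by ring
      _ < κ * t ^ 2 := by gcongr
  have h12 : r * η * t ^ 2 ≤ κ / 2 * t ^ 2 := by gcongr
  linarith

end Touching

/-! ### Fields orthogonal to a given field. -/

section Bracket

variable {E : Type*} [NormedAddCommGroup E] [InnerProductSpace ℝ E]

/-- A vector field orthogonal to `a`, equal to a multiple of `ξ` where `a` is parallel to `a₀`. -/
def horizontalExtension (a : E → E) (a₀ ξ : E) (x : E) : E := ⟪a₀, a x⟫ • ξ - ⟪ξ, a x⟫ • a₀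

lemma inner_horizontalExtension (a : E → E) (a₀ ξ x : E) :
    ⟪a x, horizontalExtension a a₀ ξ x⟫ = 0 := by
  rw [horizontalExtension, inner_sub_right, inner_smul_right, inner_smul_right,
    real_inner_comm (a x) ξ, real_inner_comm (a x) a₀]
  ring

lemma ContDiffAt.horizontalExtension {a : E → E} {x : E} (ha : ContDiffAt ℝ 1 a x) (a₀ ξ : E) :
    ContDiffAt ℝ 1 (horizontalExtension a a₀ ξ) x :=
  ((contDiffAt_const.inner ℝ ha).smul contDiffAt_const).sub
    ((contDiffAt_const.inner ℝ ha).smul contDiffAt_const)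

lemma HasStrictFDerivAt.horizontalExtension {a : E → E} {A : E →L[ℝ] E} {x : E}
    (ha : HasStrictFDerivAt a A x) (a₀ ξ : E) :
    HasStrictFDerivAt (horizontalExtension a a₀ ξ)
      (((innerSL ℝ a₀).comp A).smulRight ξ - ((innerSL ℝ ξ).comp A).smulRight a₀) x := by
  have h (b : E) : HasStrictFDerivAt (fun x => ⟪b, a x⟫) ((innerSL ℝ b).comp A) x :=
    (innerSL ℝ b).hasStrictFDerivAt.comp x ha
  exact ((h a₀).smul_const ξ).sub ((h ξ).smul_const a₀)

end Bracket

/-! ### The strong maximum principle. -/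

section Main

lemma inner_fderiv_gradient_comm {E : Type*} [NormedAddCommGroup E] [InnerProductSpace ℝ E]
    [CompleteSpace E] {u : E → ℝ} {x : E} (hu : ContDiffAt ℝ 2 u x) (ξ ζ : E) :
    ⟪fderiv ℝ (gradient u) x ξ, ζ⟫ = ⟪fderiv ℝ (gradient u) x ζ, ξ⟫ := by
  have hsymm : IsSymmSndFDerivAt ℝ u x := hu.isSymmSndFDerivAt (by simp)
  have hd : DifferentiableAt ℝ (fderiv ℝ u) x :=
    (hu.fderiv_right (m := 1) (by norm_num)).differentiableAt (by simp)
  have hg : DifferentiableAt ℝ (gradient u) x := hu.gradient.differentiableAt (by simp)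
  have h (ξ ζ : E) : ⟪fderiv ℝ (gradient u) x ξ, ζ⟫ = fderiv ℝ (fderiv ℝ u) x ξ ζ := by
    have h1 : HasFDerivAt (fun x => ⟪ζ, gradient u x⟫)
        ((innerSL ℝ ζ).comp (fderiv ℝ (gradient u) x)) x :=
      (innerSL ℝ ζ).hasFDerivAt.comp x hg.hasFDerivAt
    have h2 : HasFDerivAt (fun x => fderiv ℝ u x ζ) ((fderiv ℝ (fderiv ℝ u) x).flip ζ) x := by
      simpa using hd.hasFDerivAt.clm_apply (hasFDerivAt_const ζ x)
    have h3 : (fun x => ⟪ζ, gradient u x⟫) = fun x => fderiv ℝ u x ζ := by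
      funext x
      rw [real_inner_comm, inner_gradient_left]
    rw [h3] at h1
    have := congrArg (fun L : E →L[ℝ] ℝ => L ξ) (h1.unique h2)
    rw [real_inner_comm]
    simpa using this
  rw [h, h, hsymm.eq]

/-- Two linear conditions leave a nonzero solution in dimension three; this is where the case `m =
2` drops out. -/
lemma exists_ne_zero_inner_eq_zero {m : ℕ} (hm : 3 ≤ m) (a b : EuclideanSpace ℝ (Fin m)) :
    ∃ ξ : EuclideanSpace ℝ (Fin m), ξ ≠ 0 ∧ ⟪a, ξ⟫ = 0 ∧ ⟪b, ξ⟫ = 0 := by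
  have hlt : Module.finrank ℝ (ℝ × ℝ) < Module.finrank ℝ (EuclideanSpace ℝ (Fin m)) := by
    simp
    omega
  obtain ⟨ξ, hξ, h0⟩ := (Submodule.ne_bot_iff _).1 (LinearMap.ker_ne_bot_of_finrank_lt
    (f := ((innerSL ℝ a).prod (innerSL ℝ b)).toLinearMap) hlt)
  rw [LinearMap.mem_ker] at hξ
  have h1 : (⟪a, ξ⟫, ⟪b, ξ⟫) = ((0 : ℝ), (0 : ℝ)) := hξ
  exact ⟨ξ, h0, congrArg Prod.fst h1, congrArg Prod.snd h1⟩

/-- Strong maximum principle for the horizontal mean curvature, for a nondegenerate skew-symmetric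
linear field in dimension at least three. -/
theorem eq_of_horizontalMeanCurvature_le {m : ℕ} (hm : 3 ≤ m)
    (J : EuclideanSpace ℝ (Fin m) →L[ℝ] EuclideanSpace ℝ (Fin m))
    (hskew : ∀ x y, ⟪J x, y⟫ = -⟪x, J y⟫) (hinj : ∀ x, J x = 0 → x = 0)
    {U : Set (EuclideanSpace ℝ (Fin m))} {u v : EuclideanSpace ℝ (Fin m) → ℝ}
    (hu : ContDiffOn ℝ 2 u U) (hv : ContDiffOn ℝ 2 v U) (hUu : IsNonsingularDomain J u U)
    (hUv : IsNonsingularDomain J v U)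
    (hH : ∀ x ∈ U, horizontalMeanCurvature J u x ≤ horizontalMeanCurvature J v x)
    (huv : ∀ x ∈ U, v x ≤ u x) {p₀ : EuclideanSpace ℝ (Fin m)} (hp₀ : p₀ ∈ U)
    (h₀ : u p₀ = v p₀) : ∀ x ∈ U, u x = v x := by
  obtain ⟨hU, hUc, hu0⟩ := hUu
  set Z := {x ∈ U | u x = v x} with hZdef
  have hZcl : closure Z ∩ U ⊆ Z := by
    rintro x ⟨hx, hxU⟩
    refine ⟨hxU, ?_⟩
    have hux := ((hu.continuousOn).continuousAt (hU.mem_nhds hxU)).continuousWithinAt (s := Z)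
    have hvx := ((hv.continuousOn).continuousAt (hU.mem_nhds hxU)).continuousWithinAt (s := Z)
    have : (𝓝[Z] x).NeBot := mem_closure_iff_nhdsWithin_neBot.1 hx
    refine tendsto_nhds_unique hux.tendsto (hvx.tendsto.congr' ?_)
    filter_upwards [self_mem_nhdsWithin] with y hy using hy.2.symm
  by_contra hcon
  obtain ⟨p, hpZ, q, hpq, hballU, hdisj⟩ := exists_touching_ball (Z := Z) hU
    hUc.isPreconnected (fun x hx => hx.1) ⟨p₀, hp₀, h₀⟩ hZcl (fun h => hcon fun x hx => (h hx).2)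
  have htouch (p q : EuclideanSpace ℝ (Fin m)) (hp : p ∈ Z) (hb : ball q ‖p - q‖ ⊆ U)
      (hd : Disjoint (ball q ‖p - q‖) Z) : ∃ l : ℝ, p - q = l • (gradient u p + J p) :=
    exists_eq_smul_of_touching_ball hU hu hv J.contDiff hu0 hUv.2.2 hH huv hp hb hd
  have hup : ContDiffAt ℝ 2 u p := hu.contDiffAt (hU.mem_nhds hpZ.1)
  set a : EuclideanSpace ℝ (Fin m) → EuclideanSpace ℝ (Fin m) := fun x => gradient u x + J x
    with ha
  have hac : ContDiffAt ℝ 1 a p := hup.gradient.add J.contDiff.contDiffAt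
  have ha0 : a p ≠ 0 := hu0 p hpZ.1
  obtain ⟨R, hR, hRU⟩ := Metric.isOpen_iff.1 hU p hpZ.1
  have hZc : IsClosed (Z ∩ closedBall p (R / 2)) := by
    have : Z ∩ closedBall p (R / 2) = closure Z ∩ closedBall p (R / 2) :=
      subset_antisymm (inter_subset_inter_left _ subset_closure) fun x hx =>
        ⟨hZcl ⟨hx.1, hRU (closedBall_subset_ball (by linarith) hx.2)⟩, hx.2⟩
    rw [this]
    exact isClosed_closure.inter isClosed_closedBall
  have hinv (X : EuclideanSpace ℝ (Fin m) → EuclideanSpace ℝ (Fin m)) (hX : ContDiffAt ℝ 1 X p)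
      (hXa : ∀ x, ⟪a x, X x⟫ = 0) : LocallyFlowInvariant Z X p := by
    refine locallyFlowInvariant_of_inner_normal_eq_zero hpZ (half_pos hR) hZc hX ?_
    intro p' hp' q' hb hd
    obtain ⟨l, hl⟩ := htouch p' q' hp'.1
      (hb.trans ((ball_subset_ball (by linarith)).trans hRU)) hd
    rw [hl, inner_smul_left, hXa, mul_zero]
  have hinv' (ξ : EuclideanSpace ℝ (Fin m)) :
      LocallyFlowInvariant Z (horizontalExtension a (a p) ξ) p ∧
        LocallyFlowInvariant Z (-horizontalExtension a (a p) ξ) p :=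
    ⟨hinv _ (hac.horizontalExtension _ _) (inner_horizontalExtension a (a p) ξ),
      hinv _ (hac.horizontalExtension _ _).neg fun x => by
        rw [Pi.neg_apply, inner_neg_right, inner_horizontalExtension, neg_zero]⟩
  obtain ⟨l, hl⟩ := htouch p q hpZ hballU hdisj
  change p - q = l • a p at hl
  have hl0 : l ≠ 0 := by
    rintro rfl
    exact hpq (sub_eq_zero.1 (by rw [hl, zero_smul]))
  set A := fderiv ℝ a p with hA
  have hAst : HasStrictFDerivAt a A p := hac.hasStrictFDerivAt (by simp)
  -- The symmetric Hessian cancels, leaving twice the skew part `J`.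
  have hAsub (ξ ζ : EuclideanSpace ℝ (Fin m)) : ⟪A ξ, ζ⟫ - ⟪A ζ, ξ⟫ = 2 * ⟪J ξ, ζ⟫ := by
    have h1 : A = fderiv ℝ (gradient u) p + J := by
      rw [hA, ha, fderiv_fun_add (hup.gradient.differentiableAt (by simp)) J.differentiableAt,
        J.fderiv]
    rw [h1, add_apply, add_apply, inner_add_left, inner_add_left, inner_fderiv_gradient_comm hup ξ ζ,
      hskew ζ ξ, real_inner_comm (J ξ) ζ]
    ring
  -- the bracket of two horizontal fields is nonpositive against the inner normal
  have hbr (ξ ζ : EuclideanSpace ℝ (Fin m)) (hξ : ⟪a p, ξ⟫ = 0) (hζ : ⟪a p, ζ⟫ = 0) :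
      0 ≤ l * (⟪A ζ, ξ⟫ - ⟪A ξ, ζ⟫) := by
    obtain ⟨c, hcZ, hc⟩ := exists_commutator_curve hpZ (hAst.horizontalExtension (a p) ξ)
      (hAst.horizontalExtension (a p) ζ) (hinv' ξ).1 (hinv' ζ).1 (hinv' ξ).2 (hinv' ζ).2
    have h1 := inner_nonpos_of_curve_disjoint_ball hc hcZ hdisj
    have h2 (ξ : EuclideanSpace ℝ (Fin m)) (hξ : ⟪a p, ξ⟫ = 0) :
        horizontalExtension a (a p) ξ p = ‖a p‖ ^ 2 • ξ := by
      rw [horizontalExtension, real_inner_comm (a p) ξ, hξ, zero_smul, sub_zero,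
        real_inner_self_eq_norm_sq]
    rw [h2 ξ hξ, h2 ζ hζ, ← neg_sub p q, hl] at h1
    simp only [map_smul, sub_apply, ContinuousLinearMap.smulRight_apply,
      ContinuousLinearMap.comp_apply, innerSL_apply_apply, inner_neg_left, inner_smul_left,
      inner_sub_right, inner_smul_right, hξ, hζ, conj_trivial, mul_zero,
      real_inner_self_eq_norm_sq] at h1
    rw [real_inner_comm ξ, real_inner_comm ζ]
    have h3 : 0 < ‖a p‖ ^ 2 * ‖a p‖ ^ 2 := by
      have := norm_pos_iff.2 ha0
      positivity
    refine nonneg_of_mul_nonneg_right (a := ‖a p‖ ^ 2 * ‖a p‖ ^ 2) ?_ h3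
    linarith
  -- Orthogonality to `J (a p)` makes `J ξ` orthogonal to `a p`, so `hbr` applies to the pair in
  -- both orders and yields equality.
  obtain ⟨ξ, hξ0, hξa, hξJ⟩ := exists_ne_zero_inner_eq_zero hm (a p) (J (a p))
  have hζa : ⟪a p, J ξ⟫ = 0 := by
    have := hskew (a p) ξ
    linarith
  have h1 := hbr ξ (J ξ) hξa hζa
  have h2 := hbr (J ξ) ξ hζa hξa
  have h3 := hAsub ξ (J ξ)
  have h4 : 0 < ⟪J ξ, J ξ⟫ := real_inner_self_pos.2 fun h => hξ0 (hinj ξ h)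
  have h5 : l * (2 * ⟪J ξ, J ξ⟫) = 0 := by
    rw [← h3]
    linarith
  rcases mul_eq_zero.1 h5 with h | h
  · exact hl0 h
  · linarith

end Main

/-! ### The Heisenberg field is linear, skew and injective. -/

section Heisenberg

lemma heisenbergField_apply_even {n : ℕ} (x : EuclideanSpace ℝ (Fin (2 * n))) {i : Fin (2 * n)}
    (hi : i.val % 2 = 0) : heisenbergField n x i = -x ⟨i.val + 1, by have := i.isLt; omega⟩ := by
  simp [heisenbergField, hi]

lemma heisenbergField_apply_odd {n : ℕ} (x : EuclideanSpace ℝ (Fin (2 * n))) {i : Fin (2 * n)}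
    (hi : i.val % 2 ≠ 0) : heisenbergField n x i = x ⟨i.val - 1, by have := i.isLt; omega⟩ := by
  simp [heisenbergField, hi]

/-- `heisenbergField` as a continuous linear map. -/
noncomputable def heisenbergCLM (n : ℕ) :
    EuclideanSpace ℝ (Fin (2 * n)) →L[ℝ] EuclideanSpace ℝ (Fin (2 * n)) :=
  LinearMap.toContinuousLinearMap
    { toFun := heisenbergField n
      map_add' := fun x y => by
        ext i
        by_cases hi : i.val % 2 = 0
        · simp [heisenbergField_apply_even _ hi]
          ring
        · simp [heisenbergField_apply_odd _ hi]
      map_smul' := fun c x => by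
        ext i
        by_cases hi : i.val % 2 = 0
        · simp [heisenbergField_apply_even _ hi]
        · simp [heisenbergField_apply_odd _ hi] }

/-- The involution exchanging the indices `2j` and `2j + 1`. -/
def pairSwap {n : ℕ} (i : Fin (2 * n)) : Fin (2 * n) :=
  if h : i.val % 2 = 0 then ⟨i.val + 1, by have := i.isLt; omega⟩
  else ⟨i.val - 1, by have := i.isLt; omega⟩

lemma pairSwap_involutive {n : ℕ} : Function.Involutive (pairSwap (n := n)) := by
  intro i
  ext
  by_cases h : i.val % 2 = 0
  · have h' : (i.val + 1) % 2 ≠ 0 := by omega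
    simp [pairSwap, h, h']
  · have h' : (i.val - 1) % 2 = 0 := by omega
    simp [pairSwap, h, h']
    omega

/-- Skew-symmetry term by term, once one sum is reindexed by `pairSwap`. -/
lemma heisenbergField_pairSwap_mul {n : ℕ} (x y : EuclideanSpace ℝ (Fin (2 * n)))
    (i : Fin (2 * n)) :
    heisenbergField n x (pairSwap i) * y (pairSwap i) = -(x i * heisenbergField n y i) := by
  by_cases h : i.val % 2 = 0
  · have h1 : pairSwap i = ⟨i.val + 1, by have := i.isLt; omega⟩ := by simp [pairSwap, h]
    have h2 : (i.val + 1) % 2 ≠ 0 := by omega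
    rw [h1, heisenbergField_apply_even y h, heisenbergField_apply_odd x h2]
    simp
  · have h1 : pairSwap i = ⟨i.val - 1, by have := i.isLt; omega⟩ := by simp [pairSwap, h]
    have h2 : (i.val - 1) % 2 = 0 := by omega
    have h3 : i.val - 1 + 1 = i.val := by omega
    rw [h1, heisenbergField_apply_odd y h, heisenbergField_apply_even x h2]
    simp [h3]

lemma inner_heisenbergField (n : ℕ) (x y : EuclideanSpace ℝ (Fin (2 * n))) :
    ⟪heisenbergField n x, y⟫ = -⟪x, heisenbergField n y⟫ := by
  have h1 : ⟪heisenbergField n x, y⟫ = ∑ i, heisenbergField n x i * y i := by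
    rw [PiLp.inner_apply]
    exact Finset.sum_congr rfl fun i _ => by simp [mul_comm]
  have h2 : ⟪x, heisenbergField n y⟫ = ∑ i, x i * heisenbergField n y i := by
    rw [PiLp.inner_apply]
    exact Finset.sum_congr rfl fun i _ => by simp [mul_comm]
  rw [h1, h2, ← Equiv.sum_comp pairSwap_involutive.toPerm, ← Finset.sum_neg_distrib]
  exact Finset.sum_congr rfl fun i _ => heisenbergField_pairSwap_mul x y i

lemma eq_zero_of_heisenbergField_eq_zero {n : ℕ} {x : EuclideanSpace ℝ (Fin (2 * n))}
    (hx : heisenbergField n x = 0) : x = 0 := by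
  ext i
  by_cases hi : i.val % 2 = 0
  · have h1 : (i.val + 1) % 2 ≠ 0 := by omega
    have h3 := heisenbergField_apply_odd x
      (i := ⟨i.val + 1, by have := i.isLt; omega⟩) h1
    rw [hx] at h3
    simpa using h3.symm
  · have h1 : (i.val - 1) % 2 = 0 := by omega
    have h4 : i.val - 1 + 1 = i.val := by omega
    have h3 := heisenbergField_apply_even x
      (i := ⟨i.val - 1, by have := i.isLt; omega⟩) h1
    rw [hx] at h3
    simpa [h4] using h3.symm

end Heisenberg

/-! ### The planar counterexample. -/

section Example

/-- The normal is locally constant, because normalization removes the positive factor. -/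
lemma horizontalMeanCurvature_eq_zero_of_eq_smul {m : ℕ}
    {F : EuclideanSpace ℝ (Fin m) → EuclideanSpace ℝ (Fin m)} {u : EuclideanSpace ℝ (Fin m) → ℝ}
    {U : Set (EuclideanSpace ℝ (Fin m))} (hU : IsOpen U) {x e : EuclideanSpace ℝ (Fin m)}
    (hx : x ∈ U) (h : ∀ y ∈ U, ∃ k : ℝ, 0 < k ∧ gradient u y + F y = k • e) :
    horizontalMeanCurvature F u x = 0 := by
  have h1 : legendrianNormal F u =ᶠ[𝓝 x] fun _ => ‖e‖⁻¹ • e := by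
    filter_upwards [hU.mem_nhds hx] with y hy
    obtain ⟨k, hk, hy⟩ := h y hy
    rw [legendrianNormal, hy, norm_smul, Real.norm_eq_abs, abs_of_pos hk, smul_smul, mul_inv]
    congr 1
    field_simp
  rw [horizontalMeanCurvature, divergence, h1.fderiv_eq]
  simp

/-- The parameter covers both functions of the example: `k = 1` for `u`, `k = 0` for `v`. -/
lemma gradient_mul_add_mul_sq (k : ℝ) (x : EuclideanSpace ℝ (Fin (2 * 1))) :
    gradient (fun x : EuclideanSpace ℝ (Fin (2 * 1)) => x 0 * x 1 + k * x 1 ^ 2) x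
      + heisenbergField 1 x = (2 * (x 0 + k * x 1)) • EuclideanSpace.single 1 (1 : ℝ) := by
  have hc (i : Fin (2 * 1)) : HasFDerivAt (fun x : EuclideanSpace ℝ (Fin (2 * 1)) => x i)
      (EuclideanSpace.proj i : EuclideanSpace ℝ (Fin (2 * 1)) →L[ℝ] ℝ) x :=
    (EuclideanSpace.proj i : EuclideanSpace ℝ (Fin (2 * 1)) →L[ℝ] ℝ).hasFDerivAt
  have hg (i : Fin (2 * 1)) :
      gradient (fun x : EuclideanSpace ℝ (Fin (2 * 1)) => x 0 * x 1 + k * x 1 ^ 2) x i =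
      fderiv ℝ (fun x : EuclideanSpace ℝ (Fin (2 * 1)) => x 0 * x 1 + k * x 1 ^ 2) x
        (EuclideanSpace.single i 1) := by
    rw [← inner_gradient_left, EuclideanSpace.inner_single_right]
    simp
  have hf : HasFDerivAt (fun x : EuclideanSpace ℝ (Fin (2 * 1)) => x 0 * x 1 + k * x 1 ^ 2) _ x :=
    (((hc 0).mul (hc 1)).add (((hc 1).pow 2).const_mul k))
  ext i
  rw [PiLp.add_apply, hg, hf.fderiv]
  fin_cases i
  · simp [heisenbergField]
  · simp [heisenbergField]
    ring

end Example

end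

/-- The first conjunct is the strong maximum principle for `m = 2n ≥ 4`. The second says that for
`m = 2` the functions `u = x¹x² + (x²)²` and `v = x¹x²` on `U = {x¹ > 0, x¹ + x² > 0}` satisfy all
the hypotheses (indeed `H_F(u) = H_F(v) = 0`), touching exactly along `x² = 0`, but `u ≢ v`. -/
theorem corollaryI :
    (∀ (n : ℕ), 4 ≤ 2 * n →
      ∀ (U : Set (EuclideanSpace ℝ (Fin (2 * n)))) (u v : EuclideanSpace ℝ (Fin (2 * n)) → ℝ)
        (p₀ : EuclideanSpace ℝ (Fin (2 * n))),
        ContDiffOn ℝ 2 u U → ContDiffOn ℝ 2 v U →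
        IsNonsingularDomain (heisenbergField n) u U →
        IsNonsingularDomain (heisenbergField n) v U →
        (∀ x ∈ U, horizontalMeanCurvature (heisenbergField n) u x
          ≤ horizontalMeanCurvature (heisenbergField n) v x) →
        (∀ x ∈ U, v x ≤ u x) →
        p₀ ∈ U → u p₀ = v p₀ →
        ∀ x ∈ U, u x = v x) ∧
    (∀ (U : Set (EuclideanSpace ℝ (Fin (2 * 1)))) (u v : EuclideanSpace ℝ (Fin (2 * 1)) → ℝ),
      U = {x | 0 < x 0 ∧ 0 < x 0 + x 1} →
      u = (fun x => x 0 * x 1 + x 1 ^ 2) →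
      v = (fun x => x 0 * x 1) →
        ContDiffOn ℝ 2 u U ∧ ContDiffOn ℝ 2 v U ∧
        IsNonsingularDomain (heisenbergField 1) u U ∧
        IsNonsingularDomain (heisenbergField 1) v U ∧
        (∀ x ∈ U, horizontalMeanCurvature (heisenbergField 1) u x = 0 ∧
          horizontalMeanCurvature (heisenbergField 1) v x = 0) ∧
        (∀ x ∈ U, v x ≤ u x) ∧
        (∃ p₀ ∈ U, u p₀ = v p₀) ∧
        (∀ x ∈ U, u x = v x ↔ x 1 = 0) ∧
        ¬ ∀ x ∈ U, u x = v x) := by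
  refine ⟨?_, ?_⟩
  · intro n hn U u v p₀ hu hv hUu hUv hH huv hp₀ h₀
    exact eq_of_horizontalMeanCurvature_le (by omega) (heisenbergCLM n) (inner_heisenbergField n)
      (fun x hx => eq_zero_of_heisenbergField_eq_zero hx) hu hv hUu hUv hH huv hp₀ h₀
  · rintro U u v rfl rfl rfl
    set U : Set (EuclideanSpace ℝ (Fin (2 * 1))) := {x | 0 < x 0 ∧ 0 < x 0 + x 1} with hU
    have hopen : IsOpen U :=
      (isOpen_lt (g := fun x : EuclideanSpace ℝ (Fin (2 * 1)) => x 0) continuous_const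
        (by fun_prop)).inter
      (isOpen_lt (g := fun x : EuclideanSpace ℝ (Fin (2 * 1)) => x 0 + x 1) continuous_const
        (by fun_prop))
    have hconv : Convex ℝ U := by
      rintro x ⟨hx, hx'⟩ y ⟨hy, hy'⟩ a b ha hb hab
      have key {s t : ℝ} (hs : 0 < s) (ht : 0 < t) : 0 < a * s + b * t := by
        rcases ha.eq_or_lt with rfl | ha
        · have : b = 1 := by linarith
          simp [this, ht]
        · have := mul_pos ha hs
          have := mul_nonneg hb ht.le
          linarith
      refine ⟨by simpa using key hx hy, ?_⟩
      have := key hx' hy'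
      simp
      linarith
    -- `t = 0` supplies the contact point, `t = 1` a point where `u ≠ v`.
    have hmem (t : ℝ) (ht : 0 ≤ t) :
        (!₂[1, t] : EuclideanSpace ℝ (Fin (2 * 1))) ∈ U := by
      refine ⟨?_, ?_⟩
      · simp
      · simp
        linarith
    have hconn : IsConnected U := ⟨⟨_, hmem 0 le_rfl⟩, hconv.isPreconnected⟩
    have hgu (x : EuclideanSpace ℝ (Fin (2 * 1))) :
        gradient (fun x : EuclideanSpace ℝ (Fin (2 * 1)) => x 0 * x 1 + x 1 ^ 2) x
          + heisenbergField 1 x = (2 * (x 0 + x 1)) • EuclideanSpace.single 1 (1 : ℝ) := by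
      simpa using gradient_mul_add_mul_sq 1 x
    have hgv (x : EuclideanSpace ℝ (Fin (2 * 1))) :
        gradient (fun x : EuclideanSpace ℝ (Fin (2 * 1)) => x 0 * x 1) x
          + heisenbergField 1 x = (2 * x 0) • EuclideanSpace.single 1 (1 : ℝ) := by
      simpa using gradient_mul_add_mul_sq 0 x
    have hiff (x : EuclideanSpace ℝ (Fin (2 * 1))) :
        x 0 * x 1 + x 1 ^ 2 = x 0 * x 1 ↔ x 1 = 0 := by simp
    have hsingle : EuclideanSpace.single (1 : Fin (2 * 1)) (1 : ℝ) ≠ 0 := by simp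
    refine ⟨?_, ?_, ⟨hopen, hconn, fun x hx => ?_⟩, ⟨hopen, hconn, fun x hx => ?_⟩,
      fun x hx => ⟨?_, ?_⟩, fun x _ => ?_, ⟨_, hmem 0 le_rfl, ?_⟩, fun x _ => hiff x, fun h => ?_⟩
    · exact ContDiff.contDiffOn (by fun_prop)
    · exact ContDiff.contDiffOn (by fun_prop)
    · rw [hgu]
      exact smul_ne_zero (by linarith [hx.2]) hsingle
    · rw [hgv]
      exact smul_ne_zero (by linarith [hx.1]) hsingle
    · exact horizontalMeanCurvature_eq_zero_of_eq_smul hopen hx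
        fun y hy => ⟨_, by linarith [hy.2], hgu y⟩
    · exact horizontalMeanCurvature_eq_zero_of_eq_smul hopen hx
        fun y hy => ⟨_, by linarith [hy.1], hgv y⟩
    · have := sq_nonneg (x 1)
      change x 0 * x 1 ≤ x 0 * x 1 + x 1 ^ 2
      linarith
    · simp
    · have h1 := (hiff _).1 (h _ (hmem 1 zero_le_one))
      simp at h1
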